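/- Let $(X,d)$ be a compact metric space. A \emph{length system} on $X$ consists of lengths $\ell_k>0$ and topological embeddings $\Phi_k:[0,\ell_k]\to X$, $k=1,2,\dots$, such that (i) for every $x\in(0,\ell_k)$ there is $\varepsilon>0$ with $d(\Phi_k(x),\Phi_k(y))=|x-y|$ for all $y\in(0,\ell_k)$ with $|y-x|<\varepsilon$; (ii) the sets $\Phi_k((0,\ell_k))$ are pairwise disjoint; (iii) with $J_n=\bigcup_{k=1}^n\Phi_k((0,\ell_k))$ and $J_n^c=X\setminus J_n$, the set $\bigcap_{n}J_n^c$ is compact and totally disconnected. Then $X$ is called a \emph{fractal quantum graph}. It is \emph{proper} if every map $\Phi_k:(0,\ell_k)\to X$ is open, and \emph{geodesic} if any two points $x,y\in X$ are joined by an isometric copy of the interval $[0,d(x,y)]$. Let $\mathcal F_n$ be the space of all functions $f:X\to\mathbb R$ such that $f\circ\Phi_k\in H^1([0,\ell_k])$ (i.e. $f\circ\Phi_k$ is absolutely continuous with square integrable derivative) for all $k\le n$ and $f$ is locally constant on $J_n^c$ (in its subspace topology). Put $\mathcal F_*=\bigcup_n\mathcal F_n$ and, for $f,g\in\mathcal F_*$,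 \[ \mathscr E_*(f,g)=\sum_{k=1}^\infty\int_0^{\ell_k}(f\circ\Phi_k)'(t)\,(g\circ\Phi_k)'(t)\,dt, \qquad R_n(x,y)=\sup\Big\{\frac{|f(x)-f(y)|^2}{\mathscr E_*(f,f)}\ :\ f\in\mathcal F_n,\ \mathscr E_*(f,f)\ne0\Big\}. \] A \emph{resistance form} on $X$ is a pair $(\mathscr E,\operatorname{dom}\mathscr E)$ where $\operatorname{dom}\mathscr E$ is a linear space of real functions on $X$ containing the constants and $\mathscr E$ is a non-negative symmetric bilinear form on it such that: $\mathscr E(u,u)=0$ if and only if $u$ is constant; $\operatorname{dom}\mathscr E$ modulo constants is a Hilbert space under $\mathscr E$; $\operatorname{dom}\mathscr E$ separates the points of $X$; $R_{\mathscr E}(p,q):=\sup\{(u(p)-u(q))^2/\mathscr E(u,u): u\in\operatorname{dom}\mathscr E,\ \mathscr E(u,u)\neq0\}<\infty$ for all $p,q\in X$; and for $u\in\operatorname{dom}\mathscr E$ the function $\bar u=\max(0,\min(u,1))$ lies in $\operatorname{dom}\mathscr E$ and $\mathscr E(\bar u,\bar u)\le\mathscr E(u,u)$. The function $R_{\mathscr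 E}$ is its resistance metric. \textbf{Theorem.} Let $(X,d)$ be a proper geodesic fractal quantum graph with length system $(\Phi_k,\ell_k)$. Then $R_n(x,y)$ converges, for all $x,y\in X$, to a finite limit $R(x,y)$, and $R$ is a metric on $X$ which induces the same topology as $d$. Moreover, there is a resistance form $(\mathscr E,\operatorname{dom}\mathscr E)$ on $X$ with resistance metric $R_{\mathscr E}=R=\lim_{n\to\infty}R_n$ which extends $\mathscr E_*$, i.e. $\mathcal F_*\subset\operatorname{dom}\mathscr E$ and $\mathscr E(f,g)=\mathscr E_*(f,g)$ for all $f,g\in\mathcal F_*$, and such that $\mathcal F_*$ is dense in $\operatorname{dom}\mathscr E$: for every $g\in\operatorname{dom}\mathscr E$ there are $f_i\in\mathcal F_*$ with $\lim_{i\to\infty}\mathscr E(f_i-g,f_i-g)=0$. -/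

import Mathlib

open Set Filter Topology MeasureTheory
open scoped ENNReal

noncomputable section

/-- The Sobolev space `H¹([a, b])`, for everywhere defined functions: `u` is absolutely continuous
on `[a, b]` with square integrable derivative. -/
def MemH1 (u : ℝ → ℝ) (a b : ℝ) : Prop :=
  AbsolutelyContinuousOnInterval u a b ∧ MemLp (deriv u) 2 (volume.restrict (Ioo a b))

/-- A length system `(Φ_k, ℓ_k)`, indexed by `k = 0, 1, 2, …`, making the compact metric space `X` a
fractal quantum graph. The embedding `Φ_k : [0, ℓ_k] → X` is given as a map on `ℝ` of which only
the values on `[0, ℓ_k]` matter. -/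
structure FractalQuantumGraph (X : Type*) [MetricSpace X] [CompactSpace X] where
  /-- the lengths `ℓ_k` -/
  len : ℕ → ℝ
  /-- the maps `Φ_k` -/
  edge : ℕ → ℝ → X
  len_pos : ∀ k, 0 < len k
  isEmbedding : ∀ k, IsEmbedding ((Icc 0 (len k)).domRestrict (edge k))
  localIsometry : ∀ k, ∀ x ∈ Ioo 0 (len k), ∃ ε > 0, ∀ y ∈ Ioo 0 (len k),
    |y - x| < ε → dist (edge k x) (edge k y) = |x - y|
  disjoint_edges : ∀ j k, j ≠ k →
    Disjoint (edge j '' Ioo 0 (len j)) (edge k '' Ioo 0 (len k))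
  isCompact_core : IsCompact (⋂ n : ℕ, (⋃ k < n, edge k '' Ioo 0 (len k))ᶜ)
  isTotallyDisconnected_core :
    IsTotallyDisconnected (⋂ n : ℕ, (⋃ k < n, edge k '' Ioo 0 (len k))ᶜ)

namespace FractalQuantumGraph

variable {X : Type*} [MetricSpace X] [CompactSpace X] (G : FractalQuantumGraph X)

/-- `J_n`, the union of the first `n` open edges. -/
def J (n : ℕ) : Set X := ⋃ k < n, G.edge k '' Ioo 0 (G.len k)

/-- `𝓕_n`: functions that are `H¹` on the first `n` edges and locally constant on the complement
of `J_n` (with the subspace topology). -/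
def F (n : ℕ) : Set (X → ℝ) :=
  {f | (∀ k < n, MemH1 (f ∘ G.edge k) 0 (G.len k)) ∧ IsLocallyConstant (((G.J n)ᶜ).domRestrict f)}

/-- `𝓕_*`, the union of the spaces `𝓕_n`. -/
def FStar : Set (X → ℝ) := ⋃ n, G.F n

/-- `𝓔_*(f, g)`. For `f, g ∈ 𝓕_n` only the terms with `k < n` can be nonzero. -/
def energy (f g : X → ℝ) : ℝ :=
  ∑' k, ∫ t in Ioo 0 (G.len k), deriv (f ∘ G.edge k) t * deriv (g ∘ G.edge k) t

/-- `R_n(x, y)`, the supremum of `|f x - f y|² / 𝓔_*(f, f)` over the `f ∈ 𝓕_n` of nonzero energy,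
as an element of `[0, ∞]`. -/
def resistance (n : ℕ) (x y : X) : ℝ≥0∞ :=
  ⨆ (f : X → ℝ) (_ : f ∈ G.F n) (_ : G.energy f f ≠ 0),
    ENNReal.ofReal (|f x - f y| ^ 2 / G.energy f f)

/-- A fractal quantum graph is proper if the maps `Φ_k : (0, ℓ_k) → X` are open. -/
def IsProper : Prop := ∀ k, IsOpenMap ((Ioo 0 (G.len k)).domRestrict (G.edge k))

end FractalQuantumGraph

/-- Any two points `x, y` are joined by an isometric copy of the interval `[0, dist x y]`. -/
def IsGeodesicSpace (X : Type*) [MetricSpace X] : Prop :=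
  ∀ x y : X, ∃ γ : ℝ → X, γ 0 = x ∧ γ (dist x y) = y ∧
    ∀ s ∈ Icc 0 (dist x y), ∀ t ∈ Icc 0 (dist x y), dist (γ s) (γ t) = |s - t|

/-- `R` is a metric on `X` (nonnegativity follows). -/
structure IsMetric {X : Type*} (R : X → X → ℝ) : Prop where
  eq_zero_iff : ∀ x y, R x y = 0 ↔ x = y
  symm : ∀ x y, R x y = R y x
  triangle : ∀ x y z, R x z ≤ R x y + R y z

/-- The topology of `X` is the one given by the open `R`-balls. -/
def InducesTopology {X : Type*} [TopologicalSpace X] (R : X → X → ℝ) : Prop :=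
  ∀ U : Set X, IsOpen U ↔ ∀ x ∈ U, ∃ ε > 0, ∀ y, R x y < ε → y ∈ U

/-- A resistance form `(𝓔, dom 𝓔)` on a set `X`. -/
structure ResistanceForm (X : Type*) where
  /-- the domain `dom 𝓔`, a linear space of functions on `X` -/
  dom : Submodule ℝ (X → ℝ)
  /-- the bilinear form `𝓔` -/
  form : dom →ₗ[ℝ] dom →ₗ[ℝ] ℝ
  const_mem : ∀ c : ℝ, (fun _ => c) ∈ dom
  symm : ∀ u v, form u v = form v u
  nonneg : ∀ u, 0 ≤ form u u
  eq_zero_iff : ∀ u, form u u = 0 ↔ ∃ c : ℝ, ∀ x, (u : X → ℝ) x = c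
  /-- Completeness of `dom 𝓔` modulo constants for the norm `𝓔(u, u)^(1/2)`. -/
  complete : ∀ u : ℕ → dom,
    (∀ ε > 0, ∃ N, ∀ m ≥ N, ∀ n ≥ N, form (u m - u n) (u m - u n) < ε) →
      ∃ v : dom, Tendsto (fun n => form (u n - v) (u n - v)) atTop (𝓝 0)
  separates : ∀ p q : X, p ≠ q → ∃ u : dom, (u : X → ℝ) p ≠ (u : X → ℝ) q
  bddAbove : ∀ p q : X, BddAbove
    {r : ℝ | ∃ u : dom, form u u ≠ 0 ∧ r = ((u : X → ℝ) p - (u : X → ℝ) q) ^ 2 / form u u}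
  /-- The Markov property. -/
  markov : ∀ u : dom, ∃ v : dom,
    (∀ x, (v : X → ℝ) x = max 0 (min ((u : X → ℝ) x) 1)) ∧ form v v ≤ form u u

/-- The resistance metric `R_𝓔` of a resistance form; the set is bounded above, and it is empty only
if `X` has at most one point, when the value is `0`. -/
def ResistanceForm.resistance {X : Type*} (E : ResistanceForm X) (p q : X) : ℝ :=
  sSup {r : ℝ | ∃ u : E.dom,
    E.form u u ≠ 0 ∧ r = ((u : X → ℝ) p - (u : X → ℝ) q) ^ 2 / E.form u u}

end

/-! Everything rests on the estimate `(f x - f y) ^ 2 ≤ dist x y * 𝓔_*(f, f)` for `f` in `𝓕_*`. Let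
`γ` be a geodesic from `x` to `y` and let `f ∈ 𝓕_n`. Then `f` is continuous, so `f ∘ γ` takes every
value between `f x` and `f y`. On the compact set `J_n^c` the locally constant `f` has finitely many
values, so almost all of these values are taken on the parts `T_k` of the first `n` edges that `γ`
visits. The image of `T_k` has measure at most `∫_{T_k} |(f ∘ Φ_k)'|`. The length of `T_k` is at
most the time `γ` spends in edge `k`, and these times add up to at most `dist x y`. Cauchy–Schwarz
gives the estimate (`sq_sub_le_dist_mul_energy_of_mem_F`). Counting values in this way avoids
differentiating `f ∘ γ`, which may meet the core in a complicated set.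

Properness makes `𝓕_n` increase with `n`, so `R_n` increases to some `R ≤ dist`. The triangle
inequality comes from cutting `f` at the level `f y`: the energies of the two truncations add up to
at most that of `f`. Points are separated by tent functions on edges and, in the core, by clopen
partitions. As `R ≤ dist` and `X` is compact, the two topologies agree.

The resistance form is the closure of the gradient `D : 𝓕_* → ⨁ L²(0, ℓ_k)`, taken in `C(X) × ⨁ L²`.
Gradients determine functions up to constants with uniform control, by the estimate, which gives
completeness. A pointwise limit determines its gradient, because integrals of the gradient along an
edge are differences of values; this is closability. The bound by `R` passes to the closure, so
closing the form does not change the resistance. The Markov property survives by a minimal-norm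
argument (`exists_clip_mem_closedGraph`). -/

noncomputable section

/-! ### Measure of images under real functions -/

/-- The image of a set under an absolutely continuous function has measure at most the integral of
the absolute value of the derivative over this set. -/
theorem AbsolutelyContinuousOnInterval.volume_image_le {u : ℝ → ℝ} {a b : ℝ} (hab : a ≤ b)
    (hu : AbsolutelyContinuousOnInterval u a b) {T : Set ℝ} (hT : T ⊆ Ioc a b) :
    volume (u '' T) ≤ ∫⁻ t in T, ‖deriv u t‖ₑ := by
  set g : ℝ → ℝ := (Ioc a b).indicator fun t => |deriv u t| with hg
  have hint : IntegrableOn (fun t => |deriv u t|) (Ioc a b) :=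
    ((intervalIntegrable_iff_integrableOn_Ioc_of_le hab).1 hu.intervalIntegrable_deriv).abs
  have hgi : Integrable g := (integrable_indicator_iff measurableSet_Ioc).2 hint
  have hg0 : ∀ t, 0 ≤ g t := fun t => indicator_nonneg (fun _ _ => abs_nonneg _) _
  have hFsub : ∀ p q : ℝ, (∫ t in a..q, g t) - ∫ t in a..p, g t = ∫ t in p..q, g t := fun p q =>
    intervalIntegral.integral_interval_sub_left hgi.intervalIntegrable hgi.intervalIntegrable
  let F : StieltjesFunction ℝ :=
    { toFun := fun x => ∫ t in a..x, g t
      mono' := fun p q hpq => by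
        have := hFsub p q
        have h2 : 0 ≤ ∫ t in p..q, g t := intervalIntegral.integral_nonneg hpq fun t _ => hg0 t
        linarith
      right_continuous' := fun x =>
        (intervalIntegral.continuous_primitive
          (fun _ _ => hgi.intervalIntegrable) a).continuousWithinAt }
  have hF : ∀ p q : ℝ, F q - F p = ∫ t in p..q, g t := hFsub
  have hFm : F.measure = volume.withDensity fun t => ‖g t‖ₑ := by
    refine Measure.ext_of_Ioc _ _ fun p q hpq => ?_
    rw [F.measure_Ioc, withDensity_apply _ measurableSet_Ioc, hF,
      intervalIntegral.integral_of_le hpq.le,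
      ofReal_integral_eq_lintegral_ofReal hgi.integrableOn (Eventually.of_forall hg0)]
    simp only [← ofReal_norm, Real.norm_of_nonneg (hg0 _)]
  -- The outer measure of `F` is the largest one bounded by `F q - F p` on subsets of `(p, q]`, so
  -- comparing on such subsets suffices; there the image has diameter at most the increment of `F`.
  have hout : OuterMeasure.restrict (Icc a b) (OuterMeasure.comap u volume.toOuterMeasure) ≤
      F.outer := by
    refine OuterMeasure.le_ofFunction.2 fun s => ?_
    rw [F.length_eq]
    refine le_iInf fun p => le_iInf fun q => le_iInf fun hs => ?_
    have hs' : s ⊆ Ioc p q := by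
      intro x hx
      exact hs ⟨hx, fun h => (not_isBot x) h⟩
    rw [OuterMeasure.restrict_apply, OuterMeasure.comap_apply]
    refine (Real.volume_le_diam _).trans (Metric.ediam_le ?_)
    have key : ∀ x ∈ s ∩ Icc a b, ∀ y ∈ s ∩ Icc a b, x ≤ y →
        edist (u x) (u y) ≤ ENNReal.ofReal (F q - F p) := by
      intro x hx y hy hxy
      rw [edist_dist]
      refine ENNReal.ofReal_le_ofReal ?_
      have hsub : uIcc x y ⊆ uIcc a b := by
        rw [uIcc_of_le hxy, uIcc_of_le hab]; exact Icc_subset_Icc hx.2.1 hy.2.2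
      have h1 := (hu.mono hsub).integral_deriv_eq_sub
      rw [dist_comm, Real.dist_eq, ← h1, hF]
      refine (intervalIntegral.abs_integral_le_integral_abs hxy).trans ?_
      rw [intervalIntegral.integral_of_le hxy,
        intervalIntegral.integral_of_le ((hs' hx.1).1.le.trans (hs' hx.1).2)]
      have h2 : ∫ t in Ioc x y, |deriv u t| = ∫ t in Ioc x y, g t := by
        refine setIntegral_congr_fun measurableSet_Ioc fun t ht => ?_
        rw [hg, indicator_of_mem]
        exact ⟨hx.2.1.trans_lt ht.1, ht.2.trans hy.2.2⟩
      rw [h2]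
      exact setIntegral_mono_set hgi.integrableOn (Eventually.of_forall hg0)
        (Ioc_subset_Ioc (hs' hx.1).1.le (hs' hy.1).2).eventuallyLE
    rintro _ ⟨x, hx, rfl⟩ _ ⟨y, hy, rfl⟩
    rcases le_total x y with h | h
    · exact key x hx y hy h
    · rw [edist_comm]; exact key y hy x hx h
  have h1 := hout T
  rw [OuterMeasure.restrict_apply, OuterMeasure.comap_apply,
    inter_eq_left.2 (hT.trans Ioc_subset_Icc_self)] at h1
  have h2 : F.outer T = F.measure T := by
    rw [StieltjesFunction.measure]; rfl
  -- `T` need not be measurable; this form of the density formula holds for all sets because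
  -- Lebesgue measure is s-finite.
  rw [h2, hFm, withDensity_apply' _ T] at h1
  refine h1.trans ?_
  have h3 : ∫⁻ t in T, ‖g t‖ₑ ≤ ∫⁻ t in T, ‖deriv u t‖ₑ := by
    refine lintegral_mono fun t => ?_
    by_cases ht : t ∈ Ioc a b
    · simp [hg, ht]
    · simp [hg, ht]
  exact h3

/-- A map of a set of real numbers which near each of its points does not increase the distance to
this point does not increase the outer measure. -/
theorem volume_image_le_of_locally {φ : ℝ → ℝ} {O : Set ℝ}
    (h : ∀ t ∈ O, ∃ δ > 0, ∀ s ∈ O, |s - t| < δ → |φ s - φ t| ≤ |s - t|) :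
    volume (φ '' O) ≤ volume O := by
  -- The points where the radius `1 / (n + 1)` works. On pieces of `A n` shorter than this radius
  -- `φ` is 1-Lipschitz, and the sets `A n` increase to `O`.
  let A : ℕ → Set ℝ := fun n =>
    {t ∈ O | ∀ s ∈ O, |s - t| < 1 / ((n : ℝ) + 1) → |φ s - φ t| ≤ |s - t|}
  have hA : Monotone A := fun m n hmn t ht => ⟨ht.1, fun s hs hst => ht.2 s hs
    (hst.trans_le (one_div_le_one_div_of_le (by positivity) (by gcongr)))⟩
  have hU : O = ⋃ n, A n := by
    refine subset_antisymm (fun t ht => ?_) (iUnion_subset fun n t ht => ht.1)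
    obtain ⟨δ, hδ, H⟩ := h t ht
    obtain ⟨n, hn⟩ := exists_nat_one_div_lt hδ
    exact mem_iUnion.2 ⟨n, ht, fun s hs hst => H s hs (hst.trans hn)⟩
  have hAn : ∀ n, volume (φ '' A n) ≤ volume (A n) := by
    intro n
    set η : ℝ := 1 / ((n : ℝ) + 1) with hη
    have hη0 : 0 < η := by positivity
    let I : ℤ → Set ℝ := fun j => Ico (j • η) ((j + 1) • η)
    have hI : ⋃ j, I j = univ := iUnion_Ico_zsmul hη0
    have hId : Pairwise (Function.onFun Disjoint I) := by
      simpa [I, Function.onFun] using pairwise_disjoint_Ico_zsmul η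
    have hpiece : ∀ j, volume (φ '' (A n ∩ I j)) ≤ volume (A n ∩ I j) := by
      intro j
      have hL : LipschitzOnWith 1 φ (A n ∩ I j) := by
        refine LipschitzOnWith.of_dist_le_mul fun s hs t ht => ?_
        rw [NNReal.coe_one, one_mul]
        refine ht.1.2 s hs.1.1 ?_
        have h1 := hs.2
        have h2 := ht.2
        simp only [I, mem_Ico, zsmul_eq_mul, Int.cast_add, Int.cast_one] at h1 h2
        rw [abs_lt]
        constructor <;> linarith
      have := hL.hausdorffMeasure_image_le (d := 1) zero_le_one
      simpa [hausdorffMeasure_real] using this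
    calc volume (φ '' A n) = volume (⋃ j, φ '' (A n ∩ I j)) := by
          rw [← image_iUnion, ← inter_iUnion, hI, inter_univ]
      _ ≤ ∑' j, volume (φ '' (A n ∩ I j)) := measure_iUnion_le _
      _ ≤ ∑' j, volume (A n ∩ I j) := ENNReal.tsum_le_tsum hpiece
      _ = volume (A n) := by
          -- `A n` may fail to be measurable, so additivity is applied to the measurable intervals
          -- under the measure restricted to `A n`.
          have h1 := measure_iUnion (μ := volume.restrict (A n)) hId fun j => measurableSet_Ico
          rw [hI, Measure.restrict_apply_univ] at h1
          rw [h1]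
          exact tsum_congr fun j => by rw [Measure.restrict_apply measurableSet_Ico, inter_comm]
  calc volume (φ '' O) = volume (⋃ n, φ '' A n) := by rw [← image_iUnion, ← hU]
    _ = ⨆ n, volume (φ '' A n) :=
        Monotone.measure_iUnion fun m n hmn => image_mono (hA hmn)
    _ ≤ volume O := iSup_le fun n => (hAn n).trans (measure_mono fun t ht => ht.1)

theorem AbsolutelyContinuousOnInterval.of_dist_le {u v : ℝ → ℝ} {a b : ℝ}
    (hu : AbsolutelyContinuousOnInterval u a b)
    (h : ∀ s ∈ uIcc a b, ∀ t ∈ uIcc a b, dist (v s) (v t) ≤ dist (u s) (u t)) :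
    AbsolutelyContinuousOnInterval v a b := by
  rw [absolutelyContinuousOnInterval_iff] at hu ⊢
  intro ε hε
  obtain ⟨δ, hδ, H⟩ := hu ε hε
  refine ⟨δ, hδ, fun E hE hE' => (Finset.sum_le_sum fun i hi => ?_).trans_lt (H E hE hE')⟩
  exact h _ (hE.1 i hi).1 _ (hE.1 i hi).2

theorem AbsolutelyContinuousOnInterval.ae_differentiableAt_Ioo {u : ℝ → ℝ} {a b : ℝ}
    (hu : AbsolutelyContinuousOnInterval u a b) :
    ∀ᵐ t ∂volume.restrict (Ioo a b), DifferentiableAt ℝ u t := by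
  filter_upwards [ae_restrict_of_ae hu.ae_differentiableAt, ae_restrict_mem measurableSet_Ioo]
    with t h1 h2
  exact h1 (Ioo_subset_Icc_self.trans Icc_subset_uIcc h2)

theorem abs_deriv_le_of_dist_le {u v : ℝ → ℝ} {t : ℝ} (hu : DifferentiableAt ℝ u t)
    (hv : DifferentiableAt ℝ v t) (h : ∀ᶠ s in 𝓝 t, dist (v s) (v t) ≤ dist (u s) (u t)) :
    |deriv v t| ≤ |deriv u t| := by
  have h1 := hu.hasDerivAt.tendsto_slope.abs
  have h2 := hv.hasDerivAt.tendsto_slope.abs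
  refine le_of_tendsto_of_tendsto h2 h1 ?_
  filter_upwards [nhdsWithin_le_nhds h] with s hs
  rw [slope_def_field, slope_def_field, abs_div, abs_div]
  rw [Real.dist_eq, Real.dist_eq] at hs
  gcongr

/-! ### Calculus in `H¹` -/

namespace MemH1

variable {u v : ℝ → ℝ} {a b : ℝ}

theorem ae_differentiableAt (hu : MemH1 u a b) :
    ∀ᵐ t ∂volume.restrict (Ioo a b), DifferentiableAt ℝ u t :=
  hu.1.ae_differentiableAt_Ioo

theorem of_dist_le (hab : a ≤ b) (hu : MemH1 u a b)
    (h : ∀ s ∈ Icc a b, ∀ t ∈ Icc a b, dist (v s) (v t) ≤ dist (u s) (u t)) : MemH1 v a b := by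
  have hv : AbsolutelyContinuousOnInterval v a b := hu.1.of_dist_le (by rwa [uIcc_of_le hab])
  refine ⟨hv, hu.2.mono (measurable_deriv v).aestronglyMeasurable ?_⟩
  filter_upwards [hu.ae_differentiableAt, hv.ae_differentiableAt_Ioo,
    ae_restrict_mem measurableSet_Ioo] with t h1 h2 ht
  refine abs_deriv_le_of_dist_le h1 h2 ?_
  filter_upwards [Ioo_mem_nhds ht.1 ht.2] with s hs
  exact h _ (Ioo_subset_Icc_self hs) _ (Ioo_subset_Icc_self ht)

theorem congr (hab : a ≤ b) (hu : MemH1 u a b) (h : EqOn v u (Icc a b)) : MemH1 v a b :=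
  hu.of_dist_le hab fun s hs t ht => by rw [h hs, h ht]

theorem of_lipschitzWith {K : NNReal} (hu : LipschitzWith K u) : MemH1 u a b :=
  ⟨hu.lipschitzOnWith.absolutelyContinuousOnInterval,
    MemLp.of_bound (measurable_deriv u).aestronglyMeasurable K
      (Eventually.of_forall fun _ => norm_deriv_le_of_lipschitz hu)⟩

theorem const (c : ℝ) : MemH1 (fun _ => c) a b :=
  of_lipschitzWith (LipschitzWith.const c)

theorem deriv_add_ae (hu : MemH1 u a b) (hv : MemH1 v a b) :
    deriv (u + v) =ᵐ[volume.restrict (Ioo a b)] deriv u + deriv v := by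
  filter_upwards [hu.ae_differentiableAt, hv.ae_differentiableAt] with t h1 h2
  exact deriv_add h1 h2

theorem add (hu : MemH1 u a b) (hv : MemH1 v a b) : MemH1 (u + v) a b :=
  ⟨hu.1.add hv.1, (hu.2.add hv.2).ae_eq (hu.deriv_add_ae hv).symm⟩

theorem deriv_smul_eq (c : ℝ) (u : ℝ → ℝ) : deriv (c • u) = c • deriv u := by
  ext t
  exact deriv_const_smul_field c u

theorem const_smul (c : ℝ) (hu : MemH1 u a b) : MemH1 (c • u) a b :=
  ⟨hu.1.const_smul c, by rw [deriv_smul_eq]; exact hu.2.const_smul c⟩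

theorem max_const (hab : a ≤ b) (c : ℝ) (hu : MemH1 u a b) : MemH1 (fun t => max (u t) c) a b :=
  hu.of_dist_le hab fun _ _ _ _ => abs_max_sub_max_le_abs _ _ _

theorem min_const (hab : a ≤ b) (c : ℝ) (hu : MemH1 u a b) : MemH1 (fun t => min (u t) c) a b :=
  hu.of_dist_le hab fun s _ t _ => by
    have := abs_min_sub_min_le_max (u s) c (u t) c
    simpa [Real.dist_eq] using this

/-- Wherever all three derivatives exist, one truncation has an extremum, hence derivative zero, and
the other varies no faster than `u`. The level set `u = c` needs no separate treatment. -/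
theorem sq_deriv_max_add_sq_deriv_min_le (hab : a ≤ b) (c : ℝ) (hu : MemH1 u a b) :
    ∀ᵐ t ∂volume.restrict (Ioo a b),
      deriv (fun t => max (u t) c) t ^ 2 + deriv (fun t => min (u t) c) t ^ 2 ≤ deriv u t ^ 2 := by
  filter_upwards [hu.ae_differentiableAt, (hu.max_const hab c).ae_differentiableAt,
    (hu.min_const hab c).ae_differentiableAt] with t h1 h2 h3
  rcases le_total c (u t) with h | h
  · have : IsLocalMax (fun t => min (u t) c) t :=
      Eventually.of_forall fun s => by simp [h]
    rw [this.deriv_eq_zero]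
    have := abs_deriv_le_of_dist_le h1 h2
      (Eventually.of_forall fun s => abs_max_sub_max_le_abs _ _ _)
    have := sq_le_sq.2 this
    linarith
  · have : IsLocalMin (fun t => max (u t) c) t :=
      Eventually.of_forall fun s => by simp [h]
    rw [this.deriv_eq_zero]
    have := abs_deriv_le_of_dist_le h1 h3 (Eventually.of_forall fun s => by
      have := abs_min_sub_min_le_max (u s) c (u t) c
      simpa [Real.dist_eq] using this)
    have := sq_le_sq.2 this
    linarith

theorem integral_deriv (hu : MemH1 u a b) {s t : ℝ} (has : a ≤ s) (hst : s ≤ t) (htb : t ≤ b) :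
    ∫ x in Ioc s t, deriv u x = u t - u s := by
  rw [← intervalIntegral.integral_of_le hst]
  refine (hu.1.mono ?_).integral_deriv_eq_sub
  rw [uIcc_of_le hst, uIcc_of_le (has.trans (hst.trans htb))]
  exact Icc_subset_Icc has htb

theorem integrable_sq_deriv (hu : MemH1 u a b) :
    IntegrableOn (fun t => deriv u t ^ 2) (Ioo a b) := hu.2.integrable_sq

/-- Cauchy–Schwarz applied to `∫_T |u'|`. The factor `√|T|` will be summed against the time a
geodesic spends in each edge. -/
theorem volume_image_le (hab : a ≤ b) (hu : MemH1 u a b) {T : Set ℝ} (hT : T ⊆ Ioo a b) :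
    volume (u '' T) ≤
      ENNReal.ofReal (√(volume T).toReal * √(∫ t in Ioo a b, deriv u t ^ 2)) := by
  refine (hu.1.volume_image_le hab (hT.trans Ioo_subset_Ioc_self)).trans ?_
  have h := ENNReal.lintegral_mul_le_Lp_mul_Lq (volume.restrict T) Real.HolderConjugate.two_two
    (f := fun _ => 1) (g := fun t => ‖deriv u t‖ₑ) aemeasurable_const
    (measurable_deriv u).enorm.aemeasurable
  have hTfin : volume T ≠ ⊤ := ((measure_mono hT).trans_lt (by simp)).ne
  have h2 : ∫⁻ t in T, ‖deriv u t‖ₑ ^ (2 : ℝ) ≤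
      ENNReal.ofReal (∫ t in Ioo a b, deriv u t ^ 2) := by
    rw [ofReal_integral_eq_lintegral_ofReal hu.integrable_sq_deriv
      (Eventually.of_forall fun t => sq_nonneg _)]
    refine (lintegral_mono_set hT).trans (le_of_eq (lintegral_congr fun t => ?_))
    rw [← ofReal_norm, ENNReal.ofReal_rpow_of_nonneg (norm_nonneg _) (by norm_num)]
    simp
  simp only [Pi.mul_apply, one_mul, ENNReal.one_rpow, lintegral_const,
    Measure.restrict_apply_univ] at h
  refine h.trans ((mul_le_mul_right (ENNReal.rpow_le_rpow h2 (by norm_num)) _).trans (le_of_eq ?_))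
  rw [ENNReal.ofReal_mul (Real.sqrt_nonneg _), ENNReal.ofReal_rpow_of_nonneg
    (integral_nonneg fun t => sq_nonneg _) (by norm_num), ← Real.sqrt_eq_rpow]
  congr 1
  rw [Real.sqrt_eq_rpow, ← ENNReal.ofReal_rpow_of_nonneg ENNReal.toReal_nonneg (by norm_num),
    ENNReal.ofReal_toReal hTfin]

end MemH1

/-! ### Edges and the spaces `𝓕_n` -/

namespace FractalQuantumGraph

variable {X : Type*} [MetricSpace X] [CompactSpace X] (G : FractalQuantumGraph X)

theorem continuousOn_edge (k : ℕ) : ContinuousOn (G.edge k) (Icc 0 (G.len k)) :=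
  continuousOn_iff_continuous_domRestrict.2 (G.isEmbedding k).continuous

theorem injOn_edge (k : ℕ) : InjOn (G.edge k) (Icc 0 (G.len k)) :=
  injOn_iff_injective.2 (G.isEmbedding k).injective

theorem J_mono {m n : ℕ} (h : m ≤ n) : G.J m ⊆ G.J n := by
  intro x hx
  simp only [J, mem_iUnion] at hx ⊢
  obtain ⟨k, hk, hx⟩ := hx
  exact ⟨k, hk.trans_le h, hx⟩

theorem edge_mem_J {n k : ℕ} (h : k < n) {t : ℝ} (ht : t ∈ Ioo 0 (G.len k)) :
    G.edge k t ∈ G.J n := by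
  simp only [J, mem_iUnion]
  exact ⟨k, h, t, ht, rfl⟩

variable {G}

theorem IsProper.isOpen_image (hG : G.IsProper) (k : ℕ) {U : Set ℝ} (hU : IsOpen U) :
    IsOpen (G.edge k '' (Ioo 0 (G.len k) ∩ U)) := by
  have := hG k _ (hU.preimage continuous_subtype_val)
  convert this using 1
  ext x
  simp only [mem_image, mem_inter_iff, mem_preimage, Subtype.exists, Set.domRestrict_apply]
  constructor
  · rintro ⟨t, ⟨h1, h2⟩, rfl⟩
    exact ⟨t, h1, h2, rfl⟩
  · rintro ⟨t, h1, h2, rfl⟩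
    exact ⟨t, ⟨h1, h2⟩, rfl⟩

theorem IsProper.isOpen_edge (hG : G.IsProper) (k : ℕ) : IsOpen (G.edge k '' Ioo 0 (G.len k)) := by
  simpa using hG.isOpen_image k isOpen_univ

theorem IsProper.isOpen_J (hG : G.IsProper) (n : ℕ) : IsOpen (G.J n) :=
  isOpen_iUnion fun k => isOpen_iUnion fun _ => hG.isOpen_edge k

/-- An open edge is open in `X`. If it contained an end point of another edge, it would contain
nearby interior points of that edge, against disjointness. For `j = k` injectivity on the closed
interval is enough. -/
theorem IsProper.edge_notMem_image (hG : G.IsProper) {j k : ℕ} {t : ℝ} (ht : t ∈ Icc 0 (G.len k))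
    (h : j = k → t ∉ Ioo 0 (G.len k)) : G.edge k t ∉ G.edge j '' Ioo 0 (G.len j) := by
  intro hmem
  rcases eq_or_ne j k with rfl | hjk
  · obtain ⟨s, hs, hst⟩ := hmem
    exact h rfl (G.injOn_edge j (Ioo_subset_Icc_self hs) ht hst ▸ hs)
  · have h1 : G.edge k ⁻¹' (G.edge j '' Ioo 0 (G.len j)) ∈ 𝓝[Ioo 0 (G.len k)] t :=
      nhdsWithin_mono _ Ioo_subset_Icc_self
        (G.continuousOn_edge k t ht ((hG.isOpen_edge j).mem_nhds hmem))
    have h2 : t ∈ closure (Ioo 0 (G.len k)) := by rwa [closure_Ioo (G.len_pos k).ne]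
    have : (𝓝[Ioo 0 (G.len k)] t).NeBot := mem_closure_iff_nhdsWithin_neBot.1 h2
    obtain ⟨s, hs, hs'⟩ := Filter.nonempty_of_mem (inter_mem h1 self_mem_nhdsWithin)
    exact (G.disjoint_edges j k hjk).le_bot ⟨hs, s, hs', rfl⟩

theorem IsProper.edge_notMem_J (hG : G.IsProper) {n k : ℕ} {t : ℝ} (ht : t ∈ Icc 0 (G.len k))
    (h : k < n → t ∉ Ioo 0 (G.len k)) : G.edge k t ∉ G.J n := by
  simp only [J, mem_iUnion, not_exists]
  exact fun j hj => hG.edge_notMem_image ht fun hjk => h (hjk ▸ hj)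

/-- The whole closed edge is a connected subset of `J_n^c`, where `f` is locally constant. Hence
edges of index at least `n` carry no energy and `𝓕_n` increases with `n`. -/
theorem IsProper.eqOn_const_of_mem_F (hG : G.IsProper) {n k : ℕ} (hnk : n ≤ k) {f : X → ℝ}
    (hf : f ∈ G.F n) : EqOn (f ∘ G.edge k) (fun _ => f (G.edge k 0)) (Icc 0 (G.len k)) := by
  have hmem : ∀ t ∈ Icc 0 (G.len k), G.edge k t ∈ (G.J n)ᶜ := fun t ht =>
    hG.edge_notMem_J ht fun h => absurd h hnk.not_gt
  let e : Icc 0 (G.len k) → ((G.J n)ᶜ : Set X) := fun t => ⟨G.edge k t, hmem t t.2⟩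
  have he : Continuous e := (G.isEmbedding k).continuous.subtype_mk _
  have : PreconnectedSpace (Icc 0 (G.len k)) := Subtype.preconnectedSpace isPreconnected_Icc
  intro t ht
  exact (hf.2.comp_continuous he).apply_eq_of_preconnectedSpace ⟨t, ht⟩
    ⟨0, left_mem_Icc.2 (G.len_pos k).le⟩

theorem IsProper.memH1_of_mem_F (hG : G.IsProper) {n : ℕ} {f : X → ℝ} (hf : f ∈ G.F n) (k : ℕ) :
    MemH1 (f ∘ G.edge k) 0 (G.len k) := by
  rcases lt_or_ge k n with h | h
  · exact hf.1 k h
  · exact (MemH1.const _).congr (G.len_pos k).le (hG.eqOn_const_of_mem_F h hf)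

theorem IsProper.deriv_eq_zero_of_mem_F (hG : G.IsProper) {n k : ℕ} (hnk : n ≤ k) {f : X → ℝ}
    (hf : f ∈ G.F n) {t : ℝ} (ht : t ∈ Ioo 0 (G.len k)) : deriv (f ∘ G.edge k) t = 0 := by
  have h : f ∘ G.edge k =ᶠ[𝓝 t] fun _ => f (G.edge k 0) := by
    filter_upwards [Ioo_mem_nhds ht.1 ht.2] with s hs
    exact hG.eqOn_const_of_mem_F hnk hf (Ioo_subset_Icc_self hs)
  rw [h.deriv_eq, deriv_const]

theorem IsProper.F_mono (hG : G.IsProper) {m n : ℕ} (h : m ≤ n) : G.F m ⊆ G.F n := by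
  intro f hf
  refine ⟨fun k _ => hG.memH1_of_mem_F hf k, ?_⟩
  exact hf.2.comp_continuous (continuous_inclusion (compl_subset_compl.2 (G.J_mono h)))

/-- `X` is the finite union of the closed sets `J_n^c` and `Φ_k([0, ℓ_k])`, `k < n`, and `f` is
continuous along each of them. -/
theorem IsProper.continuous_of_mem_F (hG : G.IsProper) {n : ℕ} {f : X → ℝ} (hf : f ∈ G.F n) :
    Continuous f := by
  refine continuous_iff_isClosed.2 fun C hC => ?_
  have hcov : f ⁻¹' C = (G.J n)ᶜ ∩ f ⁻¹' C ∪
      ⋃ k ∈ Finset.range n, G.edge k '' (Icc 0 (G.len k) ∩ (f ∘ G.edge k) ⁻¹' C) := by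
    ext x
    simp only [mem_union, mem_inter_iff, mem_iUnion, mem_image, Finset.mem_range]
    constructor
    · intro hx
      by_cases h : x ∈ G.J n
      · right
        simp only [J, mem_iUnion] at h
        obtain ⟨k, hk, t, ht, rfl⟩ := h
        exact ⟨k, hk, t, ⟨Ioo_subset_Icc_self ht, hx⟩, rfl⟩
      · exact Or.inl ⟨h, hx⟩
    · rintro (⟨_, h⟩ | ⟨k, _, t, ⟨_, h⟩, rfl⟩)
      · exact h
      · exact h
  rw [hcov]
  refine IsClosed.union ?_ (isClosed_biUnion_finset fun k _ => ?_)
  · exact (continuousOn_iff_continuous_domRestrict.2 hf.2.continuous).preimage_isClosed_of_isClosed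
      (hG.isOpen_J n).isClosed_compl hC
  · have hc : ContinuousOn (f ∘ G.edge k) (Icc 0 (G.len k)) := by
      have := (hG.memH1_of_mem_F hf k).1.continuousOn
      rwa [uIcc_of_le (G.len_pos k).le] at this
    have h1 : IsCompact (Icc 0 (G.len k) ∩ (f ∘ G.edge k) ⁻¹' C) :=
      isCompact_Icc.of_isClosed_subset (hc.preimage_isClosed_of_isClosed isClosed_Icc hC)
        inter_subset_left
    exact (h1.image_of_continuousOn ((G.continuousOn_edge k).mono inter_subset_left)).isClosed

theorem IsProper.energy_eq_sum (hG : G.IsProper) {n : ℕ} {f : X → ℝ} (hf : f ∈ G.F n)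
    (g : X → ℝ) : G.energy f g = ∑ k ∈ Finset.range n,
      ∫ t in Ioo 0 (G.len k), deriv (f ∘ G.edge k) t * deriv (g ∘ G.edge k) t := by
  refine tsum_eq_sum fun k hk => ?_
  rw [setIntegral_congr_fun (g := fun _ => (0 : ℝ)) measurableSet_Ioo fun t ht => ?_]
  · simp
  · simp [hG.deriv_eq_zero_of_mem_F (by simpa using hk) hf ht]

theorem IsProper.energy_self_eq_sum (hG : G.IsProper) {n : ℕ} {f : X → ℝ} (hf : f ∈ G.F n) :
    G.energy f f = ∑ k ∈ Finset.range n, ∫ t in Ioo 0 (G.len k), deriv (f ∘ G.edge k) t ^ 2 := by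
  rw [hG.energy_eq_sum hf]
  simp only [pow_two]

/-! ### The energy estimate along a geodesic -/

/-- A geodesic does not run through any part of an edge twice: the part of an edge covered by the
geodesic is at most as long as the time which the geodesic spends in this edge. -/
theorem IsProper.volume_preimage_le (hG : G.IsProper) {γ : ℝ → X} {d : ℝ}
    (hγ : ∀ s ∈ Icc 0 d, ∀ t ∈ Icc 0 d, dist (γ s) (γ t) = |s - t|) (k : ℕ) :
    volume (Ioo 0 (G.len k) ∩ G.edge k ⁻¹' (γ '' Icc 0 d)) ≤
      volume (Icc 0 d ∩ γ ⁻¹' (G.edge k '' Ioo 0 (G.len k))) := by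
  set e := G.edge k
  set ℓ := G.len k
  set O := Icc 0 d ∩ γ ⁻¹' (e '' Ioo 0 ℓ)
  have hO : ∀ t ∈ O, ∃ x ∈ Ioo 0 ℓ, e x = γ t := fun t ht => ht.2
  -- `φ t` is the edge parameter of the point `γ t`; its image covers the visited part of the edge.
  choose! φ hφ hφe using hO
  have hinj : ∀ x ∈ Ioo 0 ℓ, ∀ y ∈ Ioo 0 ℓ, e x = e y → x = y := fun x hx y hy h =>
    G.injOn_edge k (Ioo_subset_Icc_self hx) (Ioo_subset_Icc_self hy) h
  refine (measure_mono (t := φ '' O) ?_).trans (volume_image_le_of_locally ?_)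
  · rintro x ⟨hx, t, ht, htx⟩
    have htO : t ∈ O := ⟨ht, x, hx, htx.symm⟩
    exact ⟨t, htO, hinj _ (hφ t htO) _ hx ((hφe t htO).trans htx)⟩
  · intro t ht
    obtain ⟨ε, hε, H⟩ := G.localIsometry k _ (hφ t ht)
    have hopen := hG.isOpen_image k (Metric.isOpen_ball (x := φ t) (ε := ε))
    have hmem : γ t ∈ e '' (Ioo 0 ℓ ∩ Metric.ball (φ t) ε) :=
      ⟨φ t, ⟨hφ t ht, Metric.mem_ball_self hε⟩, hφe t ht⟩
    -- By properness, `γ s` for `s` near `t` stays in the part of the edge where parameter distance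
    -- equals `dist`, and `γ` is isometric, so `φ` preserves the distance to `t`.
    obtain ⟨δ, hδ, hball⟩ := Metric.isOpen_iff.1 hopen _ hmem
    refine ⟨δ, hδ, fun s hs hst => ?_⟩
    obtain ⟨y, ⟨hy, hyε⟩, hye⟩ := hball (show γ s ∈ Metric.ball (γ t) δ by
      rw [Metric.mem_ball, hγ s hs.1 t ht.1]; exact hst)
    have hyφ : y = φ s := hinj _ hy _ (hφ s hs) (hye.trans (hφe s hs).symm)
    subst hyφ
    have h1 := H _ hy (by simpa [Real.dist_eq] using hyε)
    have h2 : dist (e (φ t)) (e (φ s)) = |t - s| := by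
      rw [hφe t ht, hφe s hs, hγ t ht.1 s hs.1]
    rw [abs_sub_comm, ← h1, h2, abs_sub_comm]

/-- The values between `f x` and `f y` are counted by measure: those taken off the first `n` edges
form a finite set, and those taken on edge `k` are controlled by the visited part `T k` and the
energy there. -/
theorem IsProper.sq_sub_le_dist_mul_energy_of_mem_F (hG : G.IsProper) (hX : IsGeodesicSpace X)
    {n : ℕ} {f : X → ℝ} (hf : f ∈ G.F n) (x y : X) :
    (f x - f y) ^ 2 ≤ dist x y * G.energy f f := by
  obtain ⟨γ, h0, hd, hγ⟩ := hX x y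
  set d := dist x y
  have hd0 : 0 ≤ d := dist_nonneg
  have hγc : ContinuousOn γ (Icc 0 d) := by
    have : LipschitzOnWith 1 γ (Icc 0 d) := LipschitzOnWith.of_dist_le_mul fun s hs t ht => by
      rw [hγ s hs t ht, NNReal.coe_one, one_mul, Real.dist_eq]
    exact this.continuousOn
  have hfγ : ContinuousOn (f ∘ γ) (Icc 0 d) := (hG.continuous_of_mem_F hf).comp_continuousOn hγc
  let T : ℕ → Set ℝ := fun k => Ioo 0 (G.len k) ∩ G.edge k ⁻¹' (γ '' Icc 0 d)
  let O : ℕ → Set ℝ := fun k => Icc 0 d ∩ γ ⁻¹' (G.edge k '' Ioo 0 (G.len k))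
  let I : ℕ → ℝ := fun k => ∫ t in Ioo 0 (G.len k), deriv (f ∘ G.edge k) t ^ 2
  have hI : ∀ k, 0 ≤ I k := fun k => integral_nonneg fun t => sq_nonneg _
  have hfin : (f '' (G.J n)ᶜ).Finite := by
    have : CompactSpace ((G.J n)ᶜ : Set X) :=
      isCompact_iff_compactSpace.1 (hG.isOpen_J n).isClosed_compl.isCompact
    have := hf.2.range_finite
    rwa [range_domRestrict] at this
  have hcov : uIcc (f x) (f y) ⊆ f '' (G.J n)ᶜ ∪
      ⋃ k ∈ Finset.range n, (f ∘ G.edge k) '' T k := by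
    have h1 := intermediate_value_uIcc (a := 0) (b := d) (f := f ∘ γ) (by rwa [uIcc_of_le hd0])
    simp only [Function.comp_apply, h0, hd, uIcc_of_le hd0] at h1
    refine h1.trans ?_
    rintro _ ⟨t, ht, rfl⟩
    by_cases h : γ t ∈ G.J n
    · right
      simp only [J, mem_iUnion] at h
      obtain ⟨k, hk, s, hs, hst⟩ := h
      simp only [mem_iUnion, Finset.mem_range]
      exact ⟨k, hk, s, ⟨hs, t, ht, hst.symm⟩, by simp [hst]⟩
    · exact Or.inl ⟨_, h, rfl⟩
  have hvol : ENNReal.ofReal |f x - f y| ≤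
      ENNReal.ofReal (∑ k ∈ Finset.range n, √(volume (T k)).toReal * √(I k)) := by
    calc ENNReal.ofReal |f x - f y| = volume (uIcc (f x) (f y)) := by
          rw [Real.volume_interval, abs_sub_comm]
      _ ≤ volume (f '' (G.J n)ᶜ) + volume (⋃ k ∈ Finset.range n, (f ∘ G.edge k) '' T k) :=
          (measure_mono hcov).trans (measure_union_le _ _)
      _ ≤ 0 + ∑ k ∈ Finset.range n, volume ((f ∘ G.edge k) '' T k) :=
          add_le_add (hfin.measure_zero _).le (measure_biUnion_finset_le _ _)
      _ ≤ ∑ k ∈ Finset.range n, ENNReal.ofReal (√(volume (T k)).toReal * √(I k)) := by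
          rw [zero_add]
          exact Finset.sum_le_sum fun k _ =>
            (hG.memH1_of_mem_F hf k).volume_image_le (G.len_pos k).le inter_subset_left
      _ = _ := (ENNReal.ofReal_sum_of_nonneg fun k _ => by positivity).symm
  have hsum0 : 0 ≤ ∑ k ∈ Finset.range n, √(volume (T k)).toReal * √(I k) :=
    Finset.sum_nonneg fun k _ => by positivity
  have habs := (ENNReal.ofReal_le_ofReal_iff hsum0).1 hvol
  -- The times spent in different edges are disjoint subsets of `[0, d]`.
  have hOd : ∑ k ∈ Finset.range n, volume (O k) ≤ ENNReal.ofReal d := by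
    rw [← measure_biUnion_finset]
    · refine (measure_mono (iUnion₂_subset fun k _ => inter_subset_left)).trans ?_
      simp
    · intro j _ k _ hjk
      refine disjoint_left.2 fun t h1 h2 => (G.disjoint_edges j k hjk).le_bot ⟨h1.2, h2.2⟩
    · intro k _
      obtain ⟨U, hU, hUeq⟩ := (continuousOn_iff'.1 hγc) _ (hG.isOpen_edge k)
      have : O k = U ∩ Icc 0 d := by rw [← hUeq, inter_comm]
      rw [this]
      exact hU.measurableSet.inter measurableSet_Icc
  have hTd : ∑ k ∈ Finset.range n, (volume (T k)).toReal ≤ d := by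
    have hle : ∑ k ∈ Finset.range n, volume (T k) ≤ ENNReal.ofReal d :=
      (Finset.sum_le_sum fun k _ => hG.volume_preimage_le hγ k).trans hOd
    rw [← ENNReal.toReal_sum fun k hk => ?_]
    · exact ENNReal.toReal_le_of_le_ofReal hd0 hle
    · exact ((measure_mono inter_subset_left).trans_lt (by simp)).ne
  calc (f x - f y) ^ 2 = |f x - f y| ^ 2 := (sq_abs _).symm
    _ ≤ (∑ k ∈ Finset.range n, √(volume (T k)).toReal * √(I k)) ^ 2 := by gcongr
    _ ≤ (∑ k ∈ Finset.range n, √(volume (T k)).toReal ^ 2) * ∑ k ∈ Finset.range n, √(I k) ^ 2 :=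
        Finset.sum_mul_sq_le_sq_mul_sq _ _ _
    _ = (∑ k ∈ Finset.range n, (volume (T k)).toReal) * G.energy f f := by
        rw [hG.energy_self_eq_sum hf]
        congr 1
        · exact Finset.sum_congr rfl fun k _ => Real.sq_sqrt ENNReal.toReal_nonneg
        · exact Finset.sum_congr rfl fun k _ => Real.sq_sqrt (hI k)
    _ ≤ d * G.energy f f := by
        refine mul_le_mul_of_nonneg_right hTd ?_
        rw [hG.energy_self_eq_sum hf]
        exact Finset.sum_nonneg fun k _ => hI k

/-! ### Linear structure and truncations of `𝓕_n` -/

theorem energy_self_nonneg (f : X → ℝ) : 0 ≤ G.energy f f :=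
  tsum_nonneg fun _ => integral_nonneg fun _ => mul_self_nonneg _

theorem IsProper.add_mem_F (hG : G.IsProper) {n : ℕ} {f g : X → ℝ} (hf : f ∈ G.F n)
    (hg : g ∈ G.F n) : f + g ∈ G.F n :=
  ⟨fun k _ => (hG.memH1_of_mem_F hf k).add (hG.memH1_of_mem_F hg k), hf.2.add hg.2⟩

theorem smul_mem_F {n : ℕ} {f : X → ℝ} (c : ℝ) (hf : f ∈ G.F n) : c • f ∈ G.F n :=
  ⟨fun k hk => (hf.1 k hk).const_smul c, hf.2.comp (c • ·)⟩

theorem const_mem_F (n : ℕ) (c : ℝ) : (fun _ => c) ∈ G.F n :=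
  ⟨fun _ _ => MemH1.const c, IsLocallyConstant.const c⟩

theorem max_const_mem_F {n : ℕ} {f : X → ℝ} (c : ℝ) (hf : f ∈ G.F n) :
    (fun x => max (f x) c) ∈ G.F n :=
  ⟨fun k hk => (hf.1 k hk).max_const (G.len_pos k).le c, hf.2.comp (max · c)⟩

theorem min_const_mem_F {n : ℕ} {f : X → ℝ} (c : ℝ) (hf : f ∈ G.F n) :
    (fun x => min (f x) c) ∈ G.F n :=
  ⟨fun k hk => (hf.1 k hk).min_const (G.len_pos k).le c, hf.2.comp (min · c)⟩

theorem IsProper.energy_max_add_energy_min_le (hG : G.IsProper) {n : ℕ} {f : X → ℝ} (c : ℝ)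
    (hf : f ∈ G.F n) :
    G.energy (fun x => max (f x) c) (fun x => max (f x) c) +
      G.energy (fun x => min (f x) c) (fun x => min (f x) c) ≤ G.energy f f := by
  rw [hG.energy_self_eq_sum hf, hG.energy_self_eq_sum (max_const_mem_F c hf),
    hG.energy_self_eq_sum (min_const_mem_F c hf), ← Finset.sum_add_distrib]
  refine Finset.sum_le_sum fun k hk => ?_
  have h := hG.memH1_of_mem_F hf k
  have h1 := (hG.memH1_of_mem_F (max_const_mem_F c hf) k).integrable_sq_deriv
  have h2 := (hG.memH1_of_mem_F (min_const_mem_F c hf) k).integrable_sq_deriv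
  rw [← integral_add h1 h2]
  exact integral_mono_ae (h1.add h2) h.integrable_sq_deriv
    (h.sq_deriv_max_add_sq_deriv_min_le (G.len_pos k).le c)

/-- `𝓕_*` as a linear space. -/
def IsProper.FStarSubmodule (hG : G.IsProper) : Submodule ℝ (X → ℝ) where
  carrier := G.FStar
  zero_mem' := mem_iUnion.2 ⟨0, const_mem_F 0 0⟩
  add_mem' := by
    intro f g hf hg
    obtain ⟨m, hm⟩ := mem_iUnion.1 hf
    obtain ⟨n, hn⟩ := mem_iUnion.1 hg
    exact mem_iUnion.2 ⟨max m n, hG.add_mem_F (hG.F_mono (le_max_left _ _) hm)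
      (hG.F_mono (le_max_right _ _) hn)⟩
  smul_mem' := by
    intro c f hf
    obtain ⟨m, hm⟩ := mem_iUnion.1 hf
    exact mem_iUnion.2 ⟨m, smul_mem_F c hm⟩

end FractalQuantumGraph

/-! ### Separation of points by `𝓕_*` -/

namespace FractalQuantumGraph

variable {X : Type*} [MetricSpace X] [CompactSpace X] {G : FractalQuantumGraph X}

/-- Functions on the first `n` edges and on the complement of `J_n` with matching values at the end
points of the edges define an element of `𝓕_n`. -/
theorem exists_mem_F {n : ℕ} {g : X → ℝ} {v : ℕ → ℝ → ℝ}
    (hg : IsLocallyConstant (((G.J n)ᶜ).domRestrict g))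
    (hv : ∀ k < n, MemH1 (v k) 0 (G.len k))
    (hG : G.IsProper) (h0 : ∀ k < n, v k 0 = g (G.edge k 0))
    (h1 : ∀ k < n, v k (G.len k) = g (G.edge k (G.len k))) :
    ∃ f ∈ G.F n, (∀ x ∉ G.J n, f x = g x) ∧
      ∀ k < n, EqOn (f ∘ G.edge k) (v k) (Icc 0 (G.len k)) := by
  have hex : ∀ z, ∃ r : ℝ, (z ∉ G.J n → r = g z) ∧
      ∀ k < n, ∀ t ∈ Ioo 0 (G.len k), G.edge k t = z → r = v k t := by
    intro z
    by_cases hz : z ∈ G.J n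
    · have hz' := hz
      simp only [J, mem_iUnion] at hz'
      obtain ⟨k, hk, t, ht, rfl⟩ := hz'
      refine ⟨v k t, fun h => absurd hz h, fun j hj s hs hst => ?_⟩
      rcases eq_or_ne j k with rfl | hjk
      · rw [G.injOn_edge j (Ioo_subset_Icc_self hs) (Ioo_subset_Icc_self ht) hst]
      · exact ((G.disjoint_edges j k hjk).le_bot ⟨⟨s, hs, hst⟩, t, ht, rfl⟩).elim
    · exact ⟨g z, fun _ => rfl, fun k hk t ht hkt => absurd (hkt ▸ G.edge_mem_J hk ht) hz⟩
  choose f hf hfe using hex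
  have hedge : ∀ k < n, EqOn (f ∘ G.edge k) (v k) (Icc 0 (G.len k)) := by
    intro k hk t ht
    by_cases hto : t ∈ Ioo 0 (G.len k)
    · exact hfe _ k hk t hto rfl
    · have hJ : G.edge k t ∉ G.J n := hG.edge_notMem_J ht fun _ => hto
      rw [Function.comp_apply, hf _ hJ]
      rcases ht.1.eq_or_lt with rfl | ht0
      · exact (h0 k hk).symm
      · obtain rfl : t = G.len k := le_antisymm ht.2 (not_lt.1 fun h => hto ⟨ht0, h⟩)
        exact (h1 k hk).symm
  refine ⟨f, ⟨fun k hk => (hv k hk).congr (G.len_pos k).le (hedge k hk), ?_⟩, hf, hedge⟩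
  have : ((G.J n)ᶜ).domRestrict f = ((G.J n)ᶜ).domRestrict g := by
    ext z
    exact hf z z.2
  rwa [this]

/-- A tent on the edge through `p`, extended by zero, has its strict maximum at `p`, so it separates
`p` from every other point. -/
theorem IsProper.exists_mem_FStar_ne_of_mem_J (hG : G.IsProper) {n : ℕ} {p q : X}
    (hp : p ∈ G.J n) (hpq : p ≠ q) : ∃ f ∈ G.FStar, f p ≠ f q := by
  simp only [J, mem_iUnion] at hp
  obtain ⟨k, -, s, hs, rfl⟩ := hp
  -- The largest half-width for which the tent vanishes at both ends of the edge.
  set δ := min s (G.len k - s)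
  have hδ : 0 < δ := lt_min hs.1 (sub_pos.2 hs.2)
  let w : ℝ → ℝ := fun t => max 0 (δ - |t - s|)
  have hw : LipschitzWith 1 w := by
    refine LipschitzWith.of_dist_le_mul fun x y => ?_
    rw [NNReal.coe_one, one_mul, Real.dist_eq, Real.dist_eq]
    refine (abs_max_sub_max_le_max _ _ _ _).trans ?_
    rw [sub_self, abs_zero, max_eq_right (abs_nonneg _), sub_sub_sub_cancel_left]
    refine (abs_abs_sub_abs_le _ _).trans ?_
    rw [abs_sub_comm, sub_sub_sub_cancel_right]
  have hw0 : w 0 = 0 := by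
    refine max_eq_left ?_
    rw [zero_sub, abs_neg, abs_of_pos hs.1, sub_nonpos]
    exact min_le_left _ _
  have hw1 : w (G.len k) = 0 := by
    refine max_eq_left ?_
    rw [abs_of_pos (sub_pos.2 hs.2), sub_nonpos]
    exact min_le_right _ _
  obtain ⟨f, hf, hfJ, hfe⟩ := exists_mem_F (G := G) (n := k + 1) (g := fun _ => 0)
    (v := fun j => if j = k then w else fun _ => 0) (IsLocallyConstant.const 0)
    (fun j _ => by
      split_ifs
      · exact MemH1.of_lipschitzWith hw
      · exact MemH1.const 0) hG
    (fun j _ => by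
      split_ifs
      · exact hw0
      · rfl)
    (fun j _ => by
      split_ifs with h
      · subst h; exact hw1
      · rfl)
  have hle : ∀ j < k + 1, ∀ t ∈ Ioo 0 (G.len j), G.edge j t ≠ G.edge k s →
      f (G.edge j t) < δ := by
    intro j hj t ht hne
    rw [← Function.comp_apply (f := f), hfe j hj (Ioo_subset_Icc_self ht)]
    split_ifs with h
    · subst h
      refine max_lt hδ (sub_lt_self _ (abs_pos.2 (sub_ne_zero.2 ?_)))
      rintro rfl
      exact hne rfl
    · exact hδ
  refine ⟨f, mem_iUnion.2 ⟨_, hf⟩, ?_⟩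
  have hfp : f (G.edge k s) = δ := by
    rw [← Function.comp_apply (f := f), hfe k k.lt_succ_self (Ioo_subset_Icc_self hs)]
    simp [w, hδ.le]
  rw [hfp]
  refine ne_of_gt ?_
  by_cases hq : q ∈ G.J (k + 1)
  · simp only [J, mem_iUnion] at hq
    obtain ⟨j, hj, t, ht, rfl⟩ := hq
    exact hle j hj t ht hpq.symm
  · rw [hfJ q hq]
    exact hδ

/-- A clopen partition of the core separating `p` from `q` thickens to disjoint open sets `U`, `W`.
By compactness these already cover some `J_n^c`, where the indicator of `U` is locally constant; it
is then interpolated linearly along the first `n` edges. -/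
theorem IsProper.exists_mem_FStar_ne_of_mem_core (hG : G.IsProper) {p q : X}
    (hp : p ∈ ⋂ n, (G.J n)ᶜ) (hq : q ∈ ⋂ n, (G.J n)ᶜ) (hpq : p ≠ q) :
    ∃ f ∈ G.FStar, f p ≠ f q := by
  set C := ⋂ n, (G.J n)ᶜ
  have : CompactSpace C := isCompact_iff_compactSpace.1 G.isCompact_core
  have : TotallyDisconnectedSpace C :=
    totallyDisconnectedSpace_subtype_iff.2 G.isTotallyDisconnected_core
  obtain ⟨V, hV, hpV, hqV⟩ := exists_isClopen_of_totally_separated 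
    (show (⟨p, hp⟩ : C) ≠ ⟨q, hq⟩ by simpa using hpq)
  have hA : IsCompact (Subtype.val '' V) := hV.1.isCompact.image continuous_subtype_val
  have hB : IsCompact (Subtype.val '' Vᶜ) := hV.compl.1.isCompact.image continuous_subtype_val
  have hAB : Disjoint (Subtype.val '' V) (Subtype.val '' Vᶜ) :=
    (disjoint_image_iff Subtype.val_injective).2 disjoint_compl_right
  obtain ⟨U, W, hU, hW, hAU, hBW, hUW⟩ := SeparatedNhds.of_isCompact_isCompact hA hB hAB
  have hCUW : ∀ x ∈ C, x ∈ U ∪ W := by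
    intro x hx
    by_cases h : (⟨x, hx⟩ : C) ∈ V
    · exact Or.inl (hAU ⟨_, h, rfl⟩)
    · exact Or.inr (hBW ⟨_, h, rfl⟩)
  obtain ⟨n, hn⟩ := exists_subset_nhds_of_isCompact' (V := fun n => (G.J n)ᶜ)
    (directed_of_isDirected_le fun m n h => compl_subset_compl.2 (G.J_mono h))
    (fun n => (hG.isOpen_J n).isClosed_compl.isCompact)
    (fun n => (hG.isOpen_J n).isClosed_compl) (U := U ∪ W)
    fun x hx => (hU.union hW).mem_nhds (hCUW x hx)
  classical
  let g : X → ℝ := fun x => if x ∈ U then 1 else 0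
  have hg : IsLocallyConstant (((G.J n)ᶜ).domRestrict g) := by
    refine (IsLocallyConstant.iff_eventually_eq _).2 fun z => ?_
    rcases hn z.2 with h | h
    · filter_upwards [continuousAt_subtype_val.preimage_mem_nhds (hU.mem_nhds h)] with y hy
      have hy : (y : X) ∈ U := hy
      simp [g, hy, h]
    · filter_upwards [continuousAt_subtype_val.preimage_mem_nhds (hW.mem_nhds h)] with y hy
      have hyU : (y : X) ∉ U := fun h' => disjoint_left.1 hUW h' hy
      have hzU : (z : X) ∉ U := fun h' => disjoint_left.1 hUW h' h
      simp [g, hyU, hzU]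
  obtain ⟨f, hf, hfJ, -⟩ := exists_mem_F hg (v := fun k t => g (G.edge k 0) +
      t * ((g (G.edge k (G.len k)) - g (G.edge k 0)) / G.len k))
    (fun k _ => MemH1.of_lipschitzWith (K := ‖(g (G.edge k (G.len k)) - g (G.edge k 0)) / G.len k‖₊)
      (LipschitzWith.of_dist_le_mul fun x y => by
        rw [dist_add_left, Real.dist_eq, Real.dist_eq, ← sub_mul, abs_mul, mul_comm]
        simp [abs_div])) hG
    (fun k _ => by simp)
    (fun k _ => by
      have := (G.len_pos k).ne'
      field_simp
      ring)
  refine ⟨f, mem_iUnion.2 ⟨n, hf⟩, ?_⟩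
  rw [hfJ p (mem_iInter.1 hp n), hfJ q (mem_iInter.1 hq n)]
  have hpU : p ∈ U := hAU ⟨_, hpV, rfl⟩
  have hqU : q ∉ U := fun h => disjoint_left.1 hUW h (hBW ⟨_, hqV, rfl⟩)
  simp [g, hpU, hqU]

theorem IsProper.exists_mem_FStar_ne (hG : G.IsProper) {p q : X} (hpq : p ≠ q) :
    ∃ f ∈ G.FStar, f p ≠ f q := by
  by_cases hp : p ∈ ⋂ n, (G.J n)ᶜ
  · by_cases hq : q ∈ ⋂ n, (G.J n)ᶜ
    · exact hG.exists_mem_FStar_ne_of_mem_core hp hq hpq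
    · simp only [mem_iInter, mem_compl_iff, not_forall, not_not] at hq
      obtain ⟨n, hn⟩ := hq
      obtain ⟨f, hf, hne⟩ := hG.exists_mem_FStar_ne_of_mem_J hn hpq.symm
      exact ⟨f, hf, hne.symm⟩
  · simp only [mem_iInter, mem_compl_iff, not_forall, not_not] at hp
    obtain ⟨n, hn⟩ := hp
    exact hG.exists_mem_FStar_ne_of_mem_J hn hpq

end FractalQuantumGraph

/-! ### The limit `R` of the resistances and its topology -/

namespace FractalQuantumGraph

variable {X : Type*} [MetricSpace X] [CompactSpace X] (G : FractalQuantumGraph X)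

/-- The limit of the resistances `R_n`. -/
def limResistance (x y : X) : ℝ := (⨆ n, G.resistance n x y).toReal

variable {G}

theorem limResistance_nonneg (x y : X) : 0 ≤ G.limResistance x y := ENNReal.toReal_nonneg

theorem limResistance_comm (x y : X) : G.limResistance x y = G.limResistance y x := by
  simp only [limResistance, resistance, abs_sub_comm]

theorem IsProper.sq_sub_le_dist_mul_energy (hG : G.IsProper) (hX : IsGeodesicSpace X)
    {f : X → ℝ} (hf : f ∈ G.FStar) (x y : X) : (f x - f y) ^ 2 ≤ dist x y * G.energy f f := by
  obtain ⟨n, hn⟩ := mem_iUnion.1 hf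
  exact hG.sq_sub_le_dist_mul_energy_of_mem_F hX hn x y

theorem iSup_resistance_le {c : ℝ} {x y : X}
    (h : ∀ f ∈ G.FStar, (f x - f y) ^ 2 ≤ c * G.energy f f) :
    ⨆ n, G.resistance n x y ≤ ENNReal.ofReal c := by
  refine iSup_le fun n => iSup_le fun f => iSup_le fun hf => iSup_le fun hE => ?_
  refine ENNReal.ofReal_le_ofReal ?_
  rw [div_le_iff₀ ((energy_self_nonneg f).lt_of_ne' hE), sq_abs]
  exact h f (mem_iUnion.2 ⟨n, hf⟩)

theorem limResistance_le {c : ℝ} (hc : 0 ≤ c) {x y : X}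
    (h : ∀ f ∈ G.FStar, (f x - f y) ^ 2 ≤ c * G.energy f f) : G.limResistance x y ≤ c :=
  ENNReal.toReal_le_of_le_ofReal hc (iSup_resistance_le h)

theorem IsProper.iSup_resistance_ne_top (hG : G.IsProper) (hX : IsGeodesicSpace X) (x y : X) :
    ⨆ n, G.resistance n x y ≠ ⊤ :=
  ((iSup_resistance_le fun _ hf => hG.sq_sub_le_dist_mul_energy hX hf x y).trans_lt
    ENNReal.ofReal_lt_top).ne

theorem IsProper.limResistance_le_dist (hG : G.IsProper) (hX : IsGeodesicSpace X) (x y : X) :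
    G.limResistance x y ≤ dist x y :=
  limResistance_le dist_nonneg fun _ hf => hG.sq_sub_le_dist_mul_energy hX hf x y

theorem IsProper.sq_sub_le_limResistance_mul_energy (hG : G.IsProper) (hX : IsGeodesicSpace X)
    {f : X → ℝ} (hf : f ∈ G.FStar) (x y : X) :
    (f x - f y) ^ 2 ≤ G.limResistance x y * G.energy f f := by
  -- Functions of zero energy do not enter the supremum; for them the geodesic estimate forces `f x
  -- = f y`.
  by_cases hE : G.energy f f = 0
  · have := hG.sq_sub_le_dist_mul_energy hX hf x y
    rwa [hE, mul_zero] at this ⊢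
  · obtain ⟨n, hn⟩ := mem_iUnion.1 hf
    have h1 : ENNReal.ofReal (|f x - f y| ^ 2 / G.energy f f) ≤ ⨆ n, G.resistance n x y :=
      le_iSup_of_le n (le_iSup_of_le f (le_iSup_of_le hn (le_iSup_of_le hE le_rfl)))
    rw [ENNReal.ofReal_le_iff_le_toReal (hG.iSup_resistance_ne_top hX x y),
      div_le_iff₀ ((energy_self_nonneg f).lt_of_ne' hE), sq_abs] at h1
    exact h1

theorem IsProper.tendsto_resistance (hG : G.IsProper) (hX : IsGeodesicSpace X) (x y : X) :
    Tendsto (fun n => G.resistance n x y) atTop (𝓝 (ENNReal.ofReal (G.limResistance x y))) := by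
  rw [limResistance, ENNReal.ofReal_toReal (hG.iSup_resistance_ne_top hX x y)]
  refine tendsto_atTop_iSup fun m n hmn => ?_
  exact iSup_mono fun f => iSup_le fun hf => le_iSup_of_le (hG.F_mono hmn hf) le_rfl

/-- Cutting `f` at the level `f y` gives one truncation carrying the increment from `y` to `x` and
another carrying that from `z` to `y`. Their energies add up to at most that of `f`, and
Cauchy–Schwarz in the plane combines the two bounds. -/
theorem IsProper.sq_add_le_of_mem_F (hG : G.IsProper) (hX : IsGeodesicSpace X) {n : ℕ}
    {f : X → ℝ} (hf : f ∈ G.F n) {x y z : X} (hxy : f y ≤ f x) (hyz : f z ≤ f y) :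
    (f x - f z) ^ 2 ≤ (G.limResistance x y + G.limResistance y z) * G.energy f f := by
  have hmax := hG.sq_sub_le_limResistance_mul_energy hX
    (mem_iUnion.2 ⟨n, max_const_mem_F (f y) hf⟩) x y
  have hmin := hG.sq_sub_le_limResistance_mul_energy hX
    (mem_iUnion.2 ⟨n, min_const_mem_F (f y) hf⟩) y z
  have hE := hG.energy_max_add_energy_min_le (f y) hf
  simp only [max_eq_left hxy, max_self, min_self, min_eq_left hyz] at hmax hmin
  set E₁ := G.energy (fun x => max (f x) (f y)) (fun x => max (f x) (f y))
  set E₂ := G.energy (fun x => min (f x) (f y)) (fun x => min (f x) (f y))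
  have hE₁ : 0 ≤ E₁ := energy_self_nonneg _
  have hE₂ : 0 ≤ E₂ := energy_self_nonneg _
  have hR₁ : 0 ≤ G.limResistance x y := limResistance_nonneg _ _
  have hR₂ : 0 ≤ G.limResistance y z := limResistance_nonneg _ _
  have h1 := Real.le_sqrt_of_sq_le hmax
  have h2 := Real.le_sqrt_of_sq_le hmin
  rw [Real.sqrt_mul hR₁] at h1
  rw [Real.sqrt_mul hR₂] at h2
  have h3 : f x - f z ≤ √(G.limResistance x y) * √E₁ + √(G.limResistance y z) * √E₂ := by linarith
  calc (f x - f z) ^ 2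
      ≤ (√(G.limResistance x y) * √E₁ + √(G.limResistance y z) * √E₂) ^ 2 :=
        pow_le_pow_left₀ (by linarith) h3 2
    _ ≤ (√(G.limResistance x y) ^ 2 + √(G.limResistance y z) ^ 2) * (√E₁ ^ 2 + √E₂ ^ 2) := by
        nlinarith [sq_nonneg (√(G.limResistance x y) * √E₂ - √(G.limResistance y z) * √E₁)]
    _ = (G.limResistance x y + G.limResistance y z) * (E₁ + E₂) := by
        rw [Real.sq_sqrt hR₁, Real.sq_sqrt hR₂, Real.sq_sqrt hE₁, Real.sq_sqrt hE₂]
    _ ≤ _ := mul_le_mul_of_nonneg_left hE (add_nonneg hR₁ hR₂)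

theorem IsProper.limResistance_triangle (hG : G.IsProper) (hX : IsGeodesicSpace X) (x y z : X) :
    G.limResistance x z ≤ G.limResistance x y + G.limResistance y z := by
  have hR₁ : 0 ≤ G.limResistance x y := limResistance_nonneg _ _
  have hR₂ : 0 ≤ G.limResistance y z := limResistance_nonneg _ _
  refine limResistance_le (add_nonneg hR₁ hR₂) fun f hf => ?_
  obtain ⟨n, hn⟩ := mem_iUnion.1 hf
  have hE := energy_self_nonneg (G := G) f
  have h1 := hG.sq_sub_le_limResistance_mul_energy hX hf x y
  have h2 := hG.sq_sub_le_limResistance_mul_energy hX hf y z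
  have h1' : (f x - f y) ^ 2 ≤ (G.limResistance x y + G.limResistance y z) * G.energy f f := by
    nlinarith
  have h2' : (f y - f z) ^ 2 ≤ (G.limResistance x y + G.limResistance y z) * G.energy f f := by
    nlinarith
  -- If `f y` is not between `f x` and `f z`, then `|f x - f z|` is at most one of the other two
  -- differences, and the crude bounds `h1'`, `h2'` suffice.
  rcases le_total (f y) (f x) with hxy | hxy <;> rcases le_total (f z) (f y) with hyz | hyz
  · exact hG.sq_add_le_of_mem_F hX hn hxy hyz
  · rcases le_total (f z) (f x) with hxz | hxz <;> nlinarith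
  · rcases le_total (f z) (f x) with hxz | hxz <;> nlinarith
  · have := hG.sq_add_le_of_mem_F hX hn hyz hxy
    rw [limResistance_comm z y, limResistance_comm y x] at this
    linarith [sq_abs (f x - f z), sub_sq_comm (f x) (f z)]

theorem IsProper.limResistance_self (hG : G.IsProper) (hX : IsGeodesicSpace X) (x : X) :
    G.limResistance x x = 0 :=
  le_antisymm ((hG.limResistance_le_dist hX x x).trans_eq (dist_self x)) (limResistance_nonneg _ _)

theorem IsProper.isMetric_limResistance (hG : G.IsProper) (hX : IsGeodesicSpace X) :
    IsMetric G.limResistance where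
  eq_zero_iff x y := by
    refine ⟨fun h => by_contra fun hxy => ?_, fun h => h ▸ hG.limResistance_self hX x⟩
    obtain ⟨f, hf, hne⟩ := hG.exists_mem_FStar_ne hxy
    have := hG.sq_sub_le_limResistance_mul_energy hX hf x y
    rw [h, zero_mul] at this
    exact hne (sub_eq_zero.1 (pow_eq_zero_iff two_ne_zero |>.1 (le_antisymm this (sq_nonneg _))))
  symm := limResistance_comm
  triangle := hG.limResistance_triangle hX

theorem IsProper.continuous_limResistance (hG : G.IsProper) (hX : IsGeodesicSpace X) (x : X) :
    Continuous (G.limResistance x) := by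
  have : LipschitzWith 1 (G.limResistance x) := LipschitzWith.of_le_add fun y z => by
    have h1 := hG.limResistance_triangle hX x z y
    have h2 := hG.limResistance_le_dist hX z y
    rw [dist_comm]
    linarith
  exact this.continuous

/-- `R ≤ dist` gives one direction. For the other, the continuous function `R x ·` attains a
positive minimum on the compact complement of an open set containing `x`. -/
theorem IsProper.inducesTopology_limResistance (hG : G.IsProper) (hX : IsGeodesicSpace X) :
    InducesTopology G.limResistance := by
  intro U
  constructor
  · intro hU x hx
    rcases (Uᶜ).eq_empty_or_nonempty with hne | hne
    · exact ⟨1, one_pos, fun y _ => by_contra fun hy => by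
        have : y ∈ Uᶜ := hy
        simp [hne] at this⟩
    · obtain ⟨z, hz, hmin⟩ := hU.isClosed_compl.isCompact.exists_isMinOn hne
        (hG.continuous_limResistance hX x).continuousOn
      refine ⟨G.limResistance x z, (limResistance_nonneg x z).lt_of_ne' fun h => ?_,
        fun y hy => by_contra fun hyU => (hmin hyU).not_gt hy⟩
      exact hz (((hG.isMetric_limResistance hX).eq_zero_iff x z).1 h ▸ hx)
  · intro h
    refine Metric.isOpen_iff.2 fun x hx => ?_
    obtain ⟨ε, hε, H⟩ := h x hx
    refine ⟨ε, hε, fun y hy => H y ?_⟩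
    rw [Metric.mem_ball, dist_comm] at hy
    exact (hG.limResistance_le_dist hX x y).trans_lt hy

end FractalQuantumGraph

/-! ### Closure of a gradient to a resistance form -/

namespace ResistanceForm

section Closure

variable {X : Type*} [MetricSpace X] [CompactSpace X]
  {H : Type*} [NormedAddCommGroup H] [InnerProductSpace ℝ H]
  {V : Submodule ℝ (X → ℝ)} (D : V →ₗ[ℝ] H)

/-- The graph of a gradient, as a space of pairs of a continuous function and its gradient. -/
def gradGraph : Submodule ℝ (C(X, ℝ) × H) where
  carrier := {p | ∃ f : V, (f : X → ℝ) = p.1 ∧ D f = p.2}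
  zero_mem' := ⟨0, rfl, map_zero D⟩
  add_mem' := by
    rintro p q ⟨f, hf, hf'⟩ ⟨g, hg, hg'⟩
    exact ⟨f + g, by rw [Submodule.coe_add, hf, hg]; rfl, by rw [map_add, hf', hg']; rfl⟩
  smul_mem' := by
    rintro c p ⟨f, hf, hf'⟩
    exact ⟨c • f, by rw [Submodule.coe_smul, hf]; rfl, by rw [map_smul, hf']; rfl⟩

/-- The closed graph of the gradient. -/
def closedGraph : Submodule ℝ (C(X, ℝ) × H) := (gradGraph D).topologicalClosure

variable {D}

theorem exists_seq_of_mem_closedGraph {p : C(X, ℝ) × H} (hp : p ∈ closedGraph D) :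
    ∃ f : ℕ → V, ∃ F : ℕ → C(X, ℝ), (∀ n, (f n : X → ℝ) = F n) ∧
      Tendsto F atTop (𝓝 p.1) ∧ Tendsto (fun n => D (f n)) atTop (𝓝 p.2) := by
  obtain ⟨s, hs, hsp⟩ := mem_closure_iff_seq_limit.1 hp
  choose f hf hf' using hs
  refine ⟨f, fun n => (s n).1, hf, (Prod.tendsto_iff _ _).1 hsp |>.1, ?_⟩
  simpa only [hf'] using ((Prod.tendsto_iff _ _).1 hsp).2

theorem mem_closedGraph_of_tendsto {f : ℕ → V} {F : ℕ → C(X, ℝ)} {p : C(X, ℝ) × H}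
    (hf : ∀ n, (f n : X → ℝ) = F n) (hF : Tendsto F atTop (𝓝 p.1))
    (hD : Tendsto (fun n => D (f n)) atTop (𝓝 p.2)) : p ∈ closedGraph D :=
  mem_closure_of_tendsto (b := atTop) (f := fun n => (F n, D (f n)))
    ((Prod.tendsto_iff _ _).2 ⟨hF, hD⟩) (Eventually.of_forall fun n => ⟨f n, hf n, rfl⟩)

theorem sq_sub_le_of_mem_closedGraph {R : X → X → ℝ}
    (hR : ∀ (f : V) x y, ((f : X → ℝ) x - (f : X → ℝ) y) ^ 2 ≤ R x y * ‖D f‖ ^ 2)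
    {p : C(X, ℝ) × H} (hp : p ∈ closedGraph D) (x y : X) :
    (p.1 x - p.1 y) ^ 2 ≤ R x y * ‖p.2‖ ^ 2 := by
  have hcl : IsClosed {p : C(X, ℝ) × H | (p.1 x - p.1 y) ^ 2 ≤ R x y * ‖p.2‖ ^ 2} := by
    refine isClosed_le ?_ (by fun_prop)
    exact (((continuous_eval_const x).comp continuous_fst).sub
      ((continuous_eval_const y).comp continuous_fst)).pow 2
  refine closure_minimal ?_ hcl hp
  rintro q ⟨f, hf, hf'⟩
  have := hR f x y
  rwa [hf, hf'] at this

/-- The clipping of a function in the domain of the closed gradient lies in this domain. -/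
theorem exists_clip_mem_closedGraph [CompleteSpace H]
    (hclip : ∀ f : V, ∃ g : V, (∀ x, (g : X → ℝ) x = max 0 (min ((f : X → ℝ) x) 1)) ∧
      ‖D g‖ ≤ ‖D f‖)
    (hcont : ∀ f : V, Continuous (f : X → ℝ)) {p : C(X, ℝ) × H} (hp : p ∈ closedGraph D) :
    ∃ q ∈ closedGraph D, (∀ x, q.1 x = max 0 (min (p.1 x) 1)) ∧ ‖q.2‖ ≤ ‖p.2‖ := by
  obtain ⟨f, F, hfF, hF, hD⟩ := exists_seq_of_mem_closedGraph hp
  let c : C(X, ℝ) := ⟨fun x => max 0 (min (p.1 x) 1), by fun_prop⟩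
  let δ : ℕ → ℝ := fun n => 1 / ((n : ℝ) + 1)
  have hδ : ∀ n, 0 < δ n := fun n => by positivity
  have hδ0 : Tendsto δ atTop (𝓝 0) := tendsto_one_div_add_atTop_nhds_zero_nat
  have hδa : ∀ m n, m ≤ n → δ n ≤ δ m := fun m n h =>
    one_div_le_one_div_of_le (by positivity) (by gcongr)
  -- Clipping need not be continuous for the gradient norm, so the gradients of the clipped
  -- approximants may fail to converge. Instead, almost norm-minimal elements are chosen in these
  -- decreasing convex sets of uniform approximants of `c`.
  let S : ℕ → Set V := fun n =>
    {g | (∀ x, |(g : X → ℝ) x - c x| ≤ δ n) ∧ ‖D g‖ ≤ ‖p.2‖ + δ n}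
  have hSa : ∀ m n, m ≤ n → S n ⊆ S m := fun m n h g hg =>
    ⟨fun x => (hg.1 x).trans (hδa m n h), hg.2.trans (by gcongr; exact hδa m n h)⟩
  have hSne : ∀ n, (S n).Nonempty := by
    intro n
    have h1 : ∀ᶠ i in atTop, dist (F i) p.1 < δ n := Metric.tendsto_nhds.1 hF _ (hδ n)
    have h2 : ∀ᶠ i in atTop, ‖D (f i)‖ < ‖p.2‖ + δ n :=
      hD.norm.eventually_lt_const (lt_add_of_pos_right _ (hδ n))
    obtain ⟨i, hi1, hi2⟩ := (h1.and h2).exists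
    obtain ⟨g, hg, hgD⟩ := hclip (f i)
    refine ⟨g, fun x => ?_, hgD.trans hi2.le⟩
    have h3 : |(f i : X → ℝ) x - p.1 x| ≤ δ n := by
      rw [hfF i, ← Real.dist_eq]
      exact (ContinuousMap.dist_apply_le_dist x).trans hi1.le
    rw [hg x]
    refine le_trans ?_ h3
    refine (abs_max_sub_max_le_max _ _ _ _).trans ?_
    rw [sub_self, abs_zero, max_eq_right (abs_nonneg _)]
    refine (abs_min_sub_min_le_max _ _ _ _).trans ?_
    rw [sub_self, abs_zero, max_eq_left (abs_nonneg _)]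
  let a : ℕ → ℝ := fun n => sInf ((fun g => ‖D g‖) '' S n)
  have hbdd : ∀ n, BddBelow ((fun g => ‖D g‖) '' S n) := fun n =>
    ⟨0, by rintro _ ⟨g, _, rfl⟩; exact norm_nonneg _⟩
  have ha_le : ∀ n, ∀ g ∈ S n, a n ≤ ‖D g‖ := fun n g hg => csInf_le (hbdd n) ⟨g, hg, rfl⟩
  have ha0 : ∀ n, 0 ≤ a n := fun n =>
    le_csInf ((hSne n).image _) (by rintro _ ⟨g, _, rfl⟩; exact norm_nonneg _)
  have ha_mono : Monotone a := fun m n h =>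
    csInf_le_csInf (hbdd m) ((hSne n).image _) (image_mono (hSa m n h))
  have ha_bdd : BddAbove (range a) := by
    refine ⟨‖p.2‖ + δ 0, ?_⟩
    rintro _ ⟨n, rfl⟩
    obtain ⟨g, hg⟩ := hSne n
    exact (ha_le n g hg).trans (hg.2.trans (by gcongr; exact hδa 0 n n.zero_le))
  have hex : ∀ n, ∃ g ∈ S n, ‖D g‖ < a n + δ n := by
    intro n
    obtain ⟨_, ⟨g, hg, rfl⟩, h⟩ := Real.lt_sInf_add_pos ((hSne n).image fun g => ‖D g‖) (hδ n)
    exact ⟨g, hg, h⟩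
  choose g hgS hga using hex
  set L := ⨆ n, a n
  have haL : Tendsto a atTop (𝓝 L) := tendsto_atTop_ciSup ha_mono ha_bdd
  have hleL : ∀ n, a n ≤ L := fun n => le_ciSup ha_bdd n
  have hCauchy : CauchySeq fun n => D (g n) := by
    refine cauchySeq_of_le_tendsto_0' (fun n => √(4 * (L + δ n) ^ 2 - 4 * a n ^ 2))
      (fun n m hnm => ?_) ?_
    · rw [dist_eq_norm]
      refine Real.le_sqrt_of_sq_le ?_
      -- By convexity the midpoint has gradient norm at least `a n`. The parallelogram law then
      -- bounds `‖D (g n) - D (g m)‖ ^ 2` by `4 (L + δ n) ^ 2 - 4 (a n) ^ 2`, which tends to zero.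
      have hmid : (1 / 2 : ℝ) • (g n + g m) ∈ S n := by
        have hm := hSa n m hnm (hgS m)
        have hn := hgS n
        refine ⟨fun x => ?_, ?_⟩
        · have h1 := abs_le.1 (hm.1 x)
          have h2 := abs_le.1 (hn.1 x)
          simp only [Submodule.coe_smul, Submodule.coe_add, Pi.smul_apply, Pi.add_apply,
            smul_eq_mul]
          rw [abs_le]
          constructor <;> linarith
        · have h1 := hm.2
          have h2 := hn.2
          rw [map_smul, norm_smul, map_add]
          have := norm_add_le (D (g n)) (D (g m))
          norm_num
          linarith
      have h1 := ha_le n _ hmid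
      rw [map_smul, norm_smul, map_add] at h1
      norm_num at h1
      have h2 := parallelogram_law_with_norm ℝ (D (g n)) (D (g m))
      have h3 : ‖D (g n)‖ ≤ L + δ n := (hga n).le.trans (by gcongr; exact hleL n)
      have h4 : ‖D (g m)‖ ≤ L + δ n :=
        (hga m).le.trans (add_le_add (hleL m) (hδa n m hnm))
      have h5 := pow_le_pow_left₀ (norm_nonneg _) h3 2
      have h6 := pow_le_pow_left₀ (norm_nonneg _) h4 2
      have h7 := pow_le_pow_left₀ (ha0 n) h1 2
      nlinarith
    · have : Tendsto (fun n => √(4 * (L + δ n) ^ 2 - 4 * a n ^ 2)) atTop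
          (𝓝 √(4 * (L + 0) ^ 2 - 4 * L ^ 2)) :=
        ((((hδ0.const_add L).pow 2).const_mul 4).sub ((haL.pow 2).const_mul 4)).sqrt
      simpa using this
  obtain ⟨h', hh'⟩ := cauchySeq_tendsto_of_complete hCauchy
  refine ⟨(c, h'), mem_closedGraph_of_tendsto (f := g) (F := fun n => ⟨g n, hcont (g n)⟩)
    (fun n => rfl) ?_ hh', fun x => rfl, ?_⟩
  · refine tendsto_iff_dist_tendsto_zero.2 (squeeze_zero (fun n => dist_nonneg) (fun n => ?_) hδ0)
    exact (ContinuousMap.dist_le (hδ n).le).2 fun x => (hgS n).1 x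
  · have h1 : Tendsto (fun n => ‖p.2‖ + δ n) atTop (𝓝 (‖p.2‖ + 0)) := hδ0.const_add _
    rw [add_zero] at h1
    exact le_of_tendsto_of_tendsto' hh'.norm h1 fun n => (hgS n).2

/-- Completeness of the domain of the closed gradient modulo constants. -/
theorem exists_tendsto_snd_of_cauchySeq [CompleteSpace H] [Nonempty X]
    {R : X → X → ℝ} {M : ℝ} (hRM : ∀ x y, R x y ≤ M)
    (hR : ∀ (f : V) x y, ((f : X → ℝ) x - (f : X → ℝ) y) ^ 2 ≤ R x y * ‖D f‖ ^ 2)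
    (hconst : ∀ c : ℝ, ∃ f : V, (f : X → ℝ) = (fun _ => c) ∧ D f = 0)
    {p : ℕ → C(X, ℝ) × H} (hp : ∀ n, p n ∈ closedGraph D) (hc : CauchySeq fun n => (p n).2) :
    ∃ q ∈ closedGraph D, Tendsto (fun n => (p n).2) atTop (𝓝 q.2) := by
  obtain ⟨x₀⟩ := ‹Nonempty X›
  have hbound : ∀ q ∈ closedGraph D, q.1 x₀ = 0 → ‖q.1‖ ≤ √M * ‖q.2‖ := by
    intro q hq hq0
    have hM : 0 ≤ √M * ‖q.2‖ := by positivity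
    refine (ContinuousMap.norm_le _ hM).2 fun x => ?_
    have h1 := sq_sub_le_of_mem_closedGraph hR hq x x₀
    rw [hq0, sub_zero] at h1
    have h2 : q.1 x ^ 2 ≤ M * ‖q.2‖ ^ 2 :=
      h1.trans (mul_le_mul_of_nonneg_right (hRM _ _) (sq_nonneg _))
    have h3 := Real.abs_le_sqrt h2
    rwa [Real.sqrt_mul' _ (sq_nonneg _), Real.sqrt_sq (norm_nonneg _)] at h3
  -- Subtracting a constant makes the function vanish at `x₀` without changing the gradient;
  -- `hbound` then turns Cauchy gradients into uniformly Cauchy functions.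
  have hw : ∀ n, ∃ w ∈ closedGraph D, w.2 = (p n).2 ∧ w.1 x₀ = 0 := by
    intro n
    obtain ⟨f, hf, hf'⟩ := hconst ((p n).1 x₀)
    refine ⟨p n - (ContinuousMap.const X ((p n).1 x₀), 0),
      sub_mem (hp n) (Submodule.le_topologicalClosure _ ⟨f, hf, hf'⟩), ?_, ?_⟩
    · rw [Prod.snd_sub, sub_zero]
    · rw [Prod.fst_sub, ContinuousMap.sub_apply, ContinuousMap.const_apply, sub_self]
  choose w hw hw2 hw0 using hw
  have hwdist : ∀ m n, dist (w m).1 (w n).1 ≤ √M * dist (p m).2 (p n).2 := by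
    intro m n
    have h0 : (w m - w n).1 x₀ = 0 := by
      rw [Prod.fst_sub, ContinuousMap.sub_apply, hw0, hw0, sub_self]
    have h1 := hbound _ (sub_mem (hw m) (hw n)) h0
    rwa [Prod.fst_sub, Prod.snd_sub, ← dist_eq_norm, ← dist_eq_norm, hw2, hw2] at h1
  have hc1 : CauchySeq fun n => (w n).1 := by
    refine Metric.cauchySeq_iff.2 fun ε hε => ?_
    obtain ⟨N, hN⟩ := Metric.cauchySeq_iff.1 hc (ε / (√M + 1)) (by positivity)
    refine ⟨N, fun m hm n hn => (hwdist m n).trans_lt ?_⟩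
    have h1 := hN m hm n hn
    rw [lt_div_iff₀ (by positivity)] at h1
    have h2 : 0 ≤ dist (p m).2 (p n).2 := dist_nonneg
    linarith
  obtain ⟨h, hh⟩ := cauchySeq_tendsto_of_complete hc
  obtain ⟨f, hf⟩ := cauchySeq_tendsto_of_complete hc1
  refine ⟨(f, h), (Submodule.isClosed_topologicalClosure _).mem_of_tendsto (b := atTop) (f := w)
    ((Prod.tendsto_iff _ _).2 ⟨hf, ?_⟩) (Eventually.of_forall hw), hh⟩
  simpa only [hw2] using hh

/-- The closure of a closable pre-resistance form given by a gradient `D` with values in a Hilbert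
space. -/
theorem exists_closure [CompleteSpace H] [Nonempty X]
    (hcont : ∀ f : V, Continuous (f : X → ℝ))
    (hconst : ∀ c : ℝ, ∃ f : V, (f : X → ℝ) = (fun _ => c) ∧ D f = 0)
    (hsep : ∀ p q : X, p ≠ q → ∃ f : V, (f : X → ℝ) p ≠ (f : X → ℝ) q)
    {R : X → X → ℝ} {M : ℝ} (hRM : ∀ x y, R x y ≤ M)
    (hR : ∀ (f : V) x y, ((f : X → ℝ) x - (f : X → ℝ) y) ^ 2 ≤ R x y * ‖D f‖ ^ 2)
    (hclip : ∀ f : V, ∃ g : V, (∀ x, (g : X → ℝ) x = max 0 (min ((f : X → ℝ) x) 1)) ∧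
      ‖D g‖ ≤ ‖D f‖)
    (hclosable : ∀ (f : ℕ → V) (h : H), (∀ x, Tendsto (fun n => (f n : X → ℝ) x) atTop (𝓝 0)) →
      Tendsto (fun n => D (f n)) atTop (𝓝 h) → h = 0) :
    ∃ E : ResistanceForm X, V ≤ E.dom ∧
      (∀ (f g : E.dom) (hf : (f : X → ℝ) ∈ V) (hg : (g : X → ℝ) ∈ V),
        E.form f g = inner ℝ (D ⟨f, hf⟩) (D ⟨g, hg⟩)) ∧
      (∀ (u : E.dom) x y, ((u : X → ℝ) x - (u : X → ℝ) y) ^ 2 ≤ R x y * E.form u u) ∧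
      ∀ u : E.dom, ∃ f : ℕ → E.dom, (∀ n, (f n : X → ℝ) ∈ V) ∧
        Tendsto (fun n => E.form (f n - u) (f n - u)) atTop (𝓝 0) := by
  have hzero : ∀ p ∈ closedGraph D, p.1 = 0 → p.2 = 0 := by
    intro p hp hp0
    obtain ⟨f, F, hfF, hF, hD⟩ := exists_seq_of_mem_closedGraph hp
    refine hclosable f p.2 (fun x => ?_) hD
    have := ((continuous_eval_const x).tendsto p.1).comp hF
    simp only [hfF]
    simpa [hp0, Function.comp_def] using this
  have hconst' : ∀ c : ℝ, ((ContinuousMap.const X c, 0) : C(X, ℝ) × H) ∈ closedGraph D := by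
    intro c
    obtain ⟨f, hf, hf'⟩ := hconst c
    exact Submodule.le_topologicalClosure _ ⟨f, hf, hf'⟩
  have hmem : ∀ f : V, ((⟨f, hcont f⟩, D f) : C(X, ℝ) × H) ∈ closedGraph D := fun f =>
    Submodule.le_topologicalClosure _ ⟨f, rfl, rfl⟩
  have hineq := @sq_sub_le_of_mem_closedGraph X _ _ H _ _ V D R hR
  let A : (C(X, ℝ) × H) →ₗ[ℝ] (X → ℝ) :=
    (ContinuousMap.coeFnLinearMap ℝ).comp (LinearMap.fst ℝ C(X, ℝ) H)
  let dom : Submodule ℝ (X → ℝ) := (closedGraph D).map A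
  let B : closedGraph D →ₗ[ℝ] dom := A.submoduleMap (closedGraph D)
  have hB : ∀ p : closedGraph D, ((B p : dom) : X → ℝ) = p.1.1 := fun p => rfl
  -- Injectivity is closability: a function in the domain has only one gradient, so the form can be
  -- defined on functions.
  have hBbij : Function.Bijective B := by
    refine ⟨(injective_iff_map_eq_zero B).2 fun p hp => ?_, A.submoduleMap_surjective _⟩
    have h1 : p.1.1 = 0 := by
      ext x
      have := congrFun (congrArg Subtype.val hp) x
      simpa [hB] using this
    exact Subtype.ext (Prod.ext h1 (hzero p p.2 h1))
  let e : closedGraph D ≃ₗ[ℝ] dom := LinearEquiv.ofBijective B hBbij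
  let grad : dom →ₗ[ℝ] H :=
    (LinearMap.snd ℝ C(X, ℝ) H).comp ((closedGraph D).subtype.comp e.symm.toLinearMap)
  have he : ∀ u : dom, (((e.symm u : closedGraph D) : C(X, ℝ) × H).1 : X → ℝ) = u := fun u => by
    rw [← hB]
    exact congrArg Subtype.val (e.apply_symm_apply u)
  have hgradB : ∀ p : closedGraph D, grad (B p) = p.1.2 := fun p => by
    change ((e.symm (e p) : closedGraph D) : C(X, ℝ) × H).2 = _
    rw [e.symm_apply_apply]
  have hgrad : ∀ (u : dom) (hu : (u : X → ℝ) ∈ V), grad u = D ⟨u, hu⟩ := fun u hu => by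
    have : u = B ⟨_, hmem ⟨u, hu⟩⟩ := Subtype.ext rfl
    conv_lhs => rw [this]
    exact hgradB _
  have hineq' : ∀ (u : dom) x y, ((u : X → ℝ) x - (u : X → ℝ) y) ^ 2 ≤ R x y * ‖grad u‖ ^ 2 := by
    intro u x y
    have := hineq (e.symm u).2 x y
    rwa [he u] at this
  let form : dom →ₗ[ℝ] dom →ₗ[ℝ] ℝ := (innerₗ H).compl₁₂ grad grad
  have hform : ∀ u v, form u v = inner ℝ (grad u) (grad v) := fun u v => rfl
  have hform_self : ∀ u, form u u = ‖grad u‖ ^ 2 := fun u => real_inner_self_eq_norm_sq _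
  have hVdom : V ≤ dom := fun f hf => ⟨_, hmem ⟨f, hf⟩, rfl⟩
  obtain ⟨x₀⟩ := ‹Nonempty X›
  have hdense : ∀ u : dom, ∃ f : ℕ → dom, (∀ n, (f n : X → ℝ) ∈ V) ∧
      Tendsto (fun n => form (f n - u) (f n - u)) atTop (𝓝 0) := by
    intro u
    obtain ⟨f, F, hfF, hF, hD⟩ := exists_seq_of_mem_closedGraph (e.symm u).2
    refine ⟨fun n => ⟨f n, hVdom (f n).2⟩, fun n => (f n).2, ?_⟩
    have h1 := (tendsto_iff_norm_sub_tendsto_zero.1 hD).pow 2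
    rw [zero_pow two_ne_zero] at h1
    refine h1.congr fun n => ?_
    rw [hform_self, map_sub, hgrad ⟨f n, hVdom (f n).2⟩ (f n).2]
    rfl
  refine ⟨{
    dom := dom
    form := form
    const_mem := fun c => ⟨_, hconst' c, rfl⟩
    symm := fun u v => real_inner_comm _ _
    nonneg := fun u => real_inner_self_nonneg
    eq_zero_iff := fun u => ?_
    complete := fun u hu => ?_
    separates := fun p q hpq => ?_
    bddAbove := fun p q => ?_
    markov := fun u => ?_ }, hVdom,
    fun f g hf hg => congrArg₂ (inner ℝ) (hgrad f hf) (hgrad g hg),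
    fun u x y => (hineq' u x y).trans_eq (by rw [← hform_self]), hdense⟩
  · constructor
    · intro h
      refine ⟨(u : X → ℝ) x₀, fun x => ?_⟩
      have h1 := hineq' u x x₀
      rw [← hform_self, h, mul_zero] at h1
      exact sub_eq_zero.1 (pow_eq_zero_iff two_ne_zero |>.1 (le_antisymm h1 (sq_nonneg _)))
    · rintro ⟨c, hc⟩
      have h1 : u = B ⟨_, hconst' c⟩ := Subtype.ext (funext hc)
      rw [hform_self, h1, hgradB]
      simp
  · have hc : CauchySeq fun n => (e.symm (u n)).1.2 := by
      refine Metric.cauchySeq_iff.2 fun ε hε => ?_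
      obtain ⟨N, hN⟩ := hu (ε ^ 2) (by positivity)
      refine ⟨N, fun m hm n hn => ?_⟩
      have h1 := hN m hm n hn
      rw [hform_self, map_sub] at h1
      rw [dist_eq_norm]
      exact lt_of_pow_lt_pow_left₀ 2 hε.le h1
    obtain ⟨q, hq, hlim⟩ := exists_tendsto_snd_of_cauchySeq hRM hR hconst
      (fun n => (e.symm (u n)).2) hc
    refine ⟨B ⟨q, hq⟩, ?_⟩
    have h1 := (tendsto_iff_norm_sub_tendsto_zero.1 hlim).pow 2
    rw [zero_pow two_ne_zero] at h1
    refine h1.congr fun n => ?_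
    rw [hform_self, map_sub, hgradB]
    rfl
  · obtain ⟨f, hf⟩ := hsep p q hpq
    exact ⟨⟨f, hVdom f.2⟩, hf⟩
  · refine ⟨R p q, ?_⟩
    rintro _ ⟨u, hu, rfl⟩
    have h0 : 0 < form u u := by
      rw [hform_self] at hu ⊢
      exact (sq_nonneg _).lt_of_ne' hu
    rw [div_le_iff₀ h0, hform_self]
    exact hineq' u p q
  · obtain ⟨q, hq, hqx, hq2⟩ := exists_clip_mem_closedGraph hclip hcont (e.symm u).2
    refine ⟨B ⟨q, hq⟩, fun x => ?_, ?_⟩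
    · rw [hB, hqx, he]
    · rw [hform_self, hform_self, hgradB]
      exact pow_le_pow_left₀ (norm_nonneg _) hq2 2

end Closure

end ResistanceForm

/-! ### The gradient on `𝓕_*` and its closability -/

theorem ae_eq_zero_of_forall_setIntegral_Ioc_eq_zero {g : ℝ → ℝ} {ℓ : ℝ} (hℓ : 0 < ℓ)
    (hg : IntegrableOn g (Ioo 0 ℓ)) (h : ∀ t ∈ Ioo 0 ℓ, ∫ s in Ioc 0 t, g s = 0) :
    g =ᵐ[volume.restrict (Ioo 0 ℓ)] 0 := by
  have hi : IntervalIntegrable g volume 0 ℓ :=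
    (intervalIntegrable_iff_integrableOn_Ioo_of_le hℓ.le).2 hg
  -- At almost every `t` the primitive has derivative `g t` by Lebesgue differentiation, and it
  -- vanishes near `t`.
  filter_upwards [ae_restrict_of_ae hi.ae_hasDerivAt_integral, ae_restrict_mem measurableSet_Ioo]
    with t ht hmem
  have h1 := ht (Ioo_subset_Icc_self.trans Icc_subset_uIcc hmem) 0 left_mem_uIcc
  have h2 : (fun x => ∫ s in (0 : ℝ)..x, g s) =ᶠ[𝓝 t] fun _ => 0 := by
    filter_upwards [Ioo_mem_nhds hmem.1 hmem.2] with x hx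
    rw [intervalIntegral.integral_of_le hx.1.le, h x hx]
  exact (h1.congr_of_eventuallyEq h2.symm).unique (hasDerivAt_const t 0)

namespace FractalQuantumGraph

variable {X : Type*} [MetricSpace X] [CompactSpace X] {G : FractalQuantumGraph X}

theorem IsProper.memH1_of_mem_FStar (hG : G.IsProper) {f : X → ℝ} (hf : f ∈ G.FStar) (k : ℕ) :
    MemH1 (f ∘ G.edge k) 0 (G.len k) := by
  obtain ⟨n, hn⟩ := mem_iUnion.1 hf
  exact hG.memH1_of_mem_F hn k

variable (G) in
/-- The Hilbert sum of the spaces `L²(0, ℓ_k)`. -/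
abbrev GradSpace : Type := lp (fun k => Lp ℝ 2 (volume.restrict (Ioo 0 (G.len k)))) 2

/-- The derivative of a function in `𝓕_*` along the `k`-th edge. -/
def IsProper.edgeDeriv (hG : G.IsProper) (f : hG.FStarSubmodule) (k : ℕ) :
    Lp ℝ 2 (volume.restrict (Ioo 0 (G.len k))) :=
  (hG.memH1_of_mem_FStar f.2 k).2.toLp _

theorem IsProper.coeFn_edgeDeriv (hG : G.IsProper) (f : hG.FStarSubmodule) (k : ℕ) :
    hG.edgeDeriv f k =ᵐ[volume.restrict (Ioo 0 (G.len k))] deriv ((f : X → ℝ) ∘ G.edge k) :=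
  MemLp.coeFn_toLp _

theorem IsProper.memℓp_edgeDeriv (hG : G.IsProper) (f : hG.FStarSubmodule) :
    Memℓp (hG.edgeDeriv f) 2 := by
  obtain ⟨n, hn⟩ := mem_iUnion.1 f.2
  -- Only the first `n` edges contribute, so the family has finite support.
  refine (memℓp_zero ((finite_lt_nat n).subset fun k hk => ?_)).of_exponent_ge zero_le_two
  by_contra hkn
  refine hk (Lp.ext ?_)
  filter_upwards [hG.coeFn_edgeDeriv f k, Lp.coeFn_zero ℝ 2 (volume.restrict (Ioo 0 (G.len k))),
    ae_restrict_mem measurableSet_Ioo] with t h1 h2 ht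
  rw [h1, h2, hG.deriv_eq_zero_of_mem_F (not_lt.1 hkn) hn ht]
  rfl

/-- The derivatives of the functions in `𝓕_*` along all edges. -/
def IsProper.grad (hG : G.IsProper) : hG.FStarSubmodule →ₗ[ℝ] G.GradSpace where
  toFun f := ⟨hG.edgeDeriv f, hG.memℓp_edgeDeriv f⟩
  map_add' f g := by
    refine Subtype.ext (funext fun k => ?_)
    change hG.edgeDeriv (f + g) k = hG.edgeDeriv f k + hG.edgeDeriv g k
    rw [edgeDeriv, edgeDeriv, edgeDeriv, ← MemLp.toLp_add]
    exact MemLp.toLp_congr _ _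
      ((hG.memH1_of_mem_FStar f.2 k).deriv_add_ae (hG.memH1_of_mem_FStar g.2 k))
  map_smul' c f := by
    refine Subtype.ext (funext fun k => ?_)
    change hG.edgeDeriv (c • f) k = c • hG.edgeDeriv f k
    rw [edgeDeriv, edgeDeriv, ← MemLp.toLp_const_smul]
    exact MemLp.toLp_congr _ _ (Eventually.of_forall fun t =>
      congrFun (MemH1.deriv_smul_eq c ((f : X → ℝ) ∘ G.edge k)) t)

theorem IsProper.inner_grad (hG : G.IsProper) (f g : hG.FStarSubmodule) :
    inner ℝ (hG.grad f) (hG.grad g) = G.energy f g := by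
  rw [lp.inner_eq_tsum]
  refine tsum_congr fun k => ?_
  rw [L2.inner_def]
  refine integral_congr_ae ?_
  filter_upwards [hG.coeFn_edgeDeriv f k, hG.coeFn_edgeDeriv g k] with t h1 h2
  change inner ℝ (hG.edgeDeriv f k t) (hG.edgeDeriv g k t) = _
  rw [h1, h2]
  simp [mul_comm]

theorem IsProper.norm_grad_sq (hG : G.IsProper) (f : hG.FStarSubmodule) :
    ‖hG.grad f‖ ^ 2 = G.energy f f := by
  rw [← hG.inner_grad, real_inner_self_eq_norm_sq]

theorem IsProper.setIntegral_edgeDeriv (hG : G.IsProper) (f : hG.FStarSubmodule) (k : ℕ) {t : ℝ}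
    (ht : t ∈ Ioo 0 (G.len k)) :
    ∫ s in Ioc 0 t, hG.edgeDeriv f k s ∂volume.restrict (Ioo 0 (G.len k)) =
      (f : X → ℝ) (G.edge k t) - (f : X → ℝ) (G.edge k 0) := by
  have hsub : Ioc 0 t ⊆ Ioo 0 (G.len k) := fun s hs => ⟨hs.1, hs.2.trans_lt ht.2⟩
  rw [integral_congr_ae (ae_restrict_of_ae (hG.coeFn_edgeDeriv f k)),
    Measure.restrict_restrict measurableSet_Ioc, inter_eq_left.2 hsub]
  exact (hG.memH1_of_mem_FStar f.2 k).integral_deriv le_rfl ht.1.le ht.2.le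

/-- Pairing with the indicator of `(0, t]` is continuous on `L²` and returns the difference of the
values of `f n` at `Φ_k(t)` and `Φ_k(0)`. These tend to zero, so every primitive of the limit
gradient vanishes. -/
theorem IsProper.eq_zero_of_tendsto_grad (hG : G.IsProper) {f : ℕ → hG.FStarSubmodule}
    {h : G.GradSpace} (hf : ∀ x, Tendsto (fun n => (f n : X → ℝ) x) atTop (𝓝 0))
    (hh : Tendsto (fun n => hG.grad (f n)) atTop (𝓝 h)) : h = 0 := by
  refine Subtype.ext (funext fun k => ?_)
  set μ := volume.restrict (Ioo 0 (G.len k))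
  have hk : Tendsto (fun n => hG.edgeDeriv (f n) k) atTop (𝓝 (h.1 k)) := by
    refine tendsto_iff_norm_sub_tendsto_zero.2 (squeeze_zero (fun _ => norm_nonneg _)
      (fun n => ?_) (tendsto_iff_norm_sub_tendsto_zero.1 hh))
    exact lp.norm_apply_le_norm two_ne_zero (hG.grad (f n) - h) k
  have hint : ∀ t ∈ Ioo 0 (G.len k), ∫ s in Ioc 0 t, (h.1 k) s = 0 := by
    intro t ht
    have hsub : Ioc 0 t ⊆ Ioo 0 (G.len k) := fun s hs => ⟨hs.1, hs.2.trans_lt ht.2⟩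
    have hμ : μ (Ioc 0 t) ≠ ⊤ := (measure_lt_top μ _).ne
    have h1 : Tendsto (fun n => inner ℝ (indicatorConstLp 2 measurableSet_Ioc hμ (1 : ℝ))
        (hG.edgeDeriv (f n) k)) atTop
        (𝓝 (inner ℝ (indicatorConstLp 2 measurableSet_Ioc hμ (1 : ℝ)) (h.1 k))) :=
      tendsto_const_nhds.inner hk
    simp only [L2.inner_indicatorConstLp_one] at h1
    have h2 : ∀ n, ∫ s in Ioc 0 t, hG.edgeDeriv (f n) k s ∂μ =
        (f n : X → ℝ) (G.edge k t) - (f n : X → ℝ) (G.edge k 0) := fun n =>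
      hG.setIntegral_edgeDeriv (f n) k ht
    simp only [h2] at h1
    have h3 := tendsto_nhds_unique h1 ((hf _).sub (hf _))
    rwa [sub_zero, Measure.restrict_restrict measurableSet_Ioc, inter_eq_left.2 hsub] at h3
  refine Lp.ext ?_
  have hi : IntegrableOn (h.1 k) (Ioo 0 (G.len k)) := (Lp.memLp (h.1 k)).integrable one_le_two
  exact (ae_eq_zero_of_forall_setIntegral_Ioc_eq_zero (G.len_pos k) hi hint).trans
    (Lp.coeFn_zero ℝ 2 μ).symm

/-- Truncation from above at `1` and then from below at `0`; each time the nonnegative energy of the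
discarded part is dropped. -/
theorem IsProper.exists_clip (hG : G.IsProper) (f : hG.FStarSubmodule) :
    ∃ g : hG.FStarSubmodule, (∀ x, (g : X → ℝ) x = max 0 (min ((f : X → ℝ) x) 1)) ∧
      ‖hG.grad g‖ ≤ ‖hG.grad f‖ := by
  obtain ⟨n, hn⟩ := mem_iUnion.1 f.2
  have h1 := min_const_mem_F 1 hn
  have h2 := max_const_mem_F 0 h1
  refine ⟨⟨_, mem_iUnion.2 ⟨n, h2⟩⟩, fun x => max_comm _ _, ?_⟩
  refine (pow_le_pow_iff_left₀ (norm_nonneg _) (norm_nonneg _) two_ne_zero).1 ?_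
  rw [hG.norm_grad_sq, hG.norm_grad_sq]
  have h3 := hG.energy_max_add_energy_min_le 1 hn
  have h4 := hG.energy_max_add_energy_min_le 0 h1
  have h5 := energy_self_nonneg (G := G) fun x => max ((f : X → ℝ) x) 1
  have h6 := energy_self_nonneg (G := G) fun x => min (min ((f : X → ℝ) x) 1) 0
  linarith

end FractalQuantumGraph

end

/-! ### The main theorem -/

theorem mainTheorem7 {X : Type*} [MetricSpace X] [CompactSpace X] (G : FractalQuantumGraph X)
    (hproper : G.IsProper) (hgeodesic : IsGeodesicSpace X) :
    ∃ R : X → X → ℝ,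
      (∀ x y, Tendsto (fun n => G.resistance n x y) atTop (𝓝 (ENNReal.ofReal (R x y)))) ∧
      IsMetric R ∧ InducesTopology R ∧
      ∃ E : ResistanceForm X,
        (∀ x y, E.resistance x y = R x y) ∧
        (∀ f ∈ G.FStar, f ∈ E.dom) ∧
        (∀ f g : E.dom, (f : X → ℝ) ∈ G.FStar → (g : X → ℝ) ∈ G.FStar →
          E.form f g = G.energy f g) ∧
        (∀ g : E.dom, ∃ f : ℕ → E.dom, (∀ i, (f i : X → ℝ) ∈ G.FStar) ∧
          Tendsto (fun i => E.form (f i - g) (f i - g)) atTop (𝓝 0)) := by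
  have : Nonempty X := ⟨G.edge 0 0⟩
  refine ⟨G.limResistance, hproper.tendsto_resistance hgeodesic,
    hproper.isMetric_limResistance hgeodesic, hproper.inducesTopology_limResistance hgeodesic, ?_⟩
  obtain ⟨E, hdom, hform, hineq, hdense⟩ := ResistanceForm.exists_closure
    (D := hproper.grad) (R := G.limResistance) (M := Metric.diam (univ : Set X))
    (fun f => by
      obtain ⟨n, hn⟩ := mem_iUnion.1 f.2
      exact hproper.continuous_of_mem_F hn)
    (fun c => by
      refine ⟨⟨fun _ => c, mem_iUnion.2 ⟨0, FractalQuantumGraph.const_mem_F 0 c⟩⟩, rfl, ?_⟩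
      refine norm_eq_zero.1 (pow_eq_zero_iff two_ne_zero |>.1 ?_)
      rw [hproper.norm_grad_sq]
      simp [hproper.energy_eq_sum (FractalQuantumGraph.const_mem_F 0 c)])
    (fun p q hpq => by
      obtain ⟨f, hf, hne⟩ := hproper.exists_mem_FStar_ne hpq
      exact ⟨⟨f, hf⟩, hne⟩)
    (fun x y => (hproper.limResistance_le_dist hgeodesic x y).trans
      (Metric.dist_le_diam_of_mem isCompact_univ.isBounded (mem_univ x) (mem_univ y)))
    (fun f x y => by
      rw [hproper.norm_grad_sq]
      exact hproper.sq_sub_le_limResistance_mul_energy hgeodesic f.2 x y)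
    hproper.exists_clip (fun f h => hproper.eq_zero_of_tendsto_grad)
  have henergy : ∀ f g : E.dom, (f : X → ℝ) ∈ G.FStar → (g : X → ℝ) ∈ G.FStar →
      E.form f g = G.energy f g := fun f g hf hg =>
    (hform f g hf hg).trans (hproper.inner_grad _ _)
  -- `R_𝓔 ≤ R` because the bound by `R` passed to the closure; `R ≤ R_𝓔` because `𝓕_*` lies in the
  -- domain with the same energy.
  refine ⟨E, fun x y => le_antisymm ?_ ?_, fun f hf => hdom hf, henergy, hdense⟩
  · refine Real.sSup_le ?_ (FractalQuantumGraph.limResistance_nonneg x y)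
    rintro _ ⟨u, hu, rfl⟩
    rw [div_le_iff₀ ((E.nonneg u).lt_of_ne' hu)]
    exact hineq u x y
  · refine FractalQuantumGraph.limResistance_le (Real.sSup_nonneg ?_) fun f hf => ?_
    · rintro _ ⟨u, -, rfl⟩
      exact div_nonneg (sq_nonneg _) (E.nonneg u)
    · set u : E.dom := ⟨f, hdom hf⟩
      have hu : E.form u u = G.energy f f := henergy u u hf hf
      -- Functions of zero energy are not competitors for `R_𝓔`, but they are constant.
      by_cases h0 : E.form u u = 0
      · obtain ⟨c, hc⟩ := (E.eq_zero_iff u).1 h0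
        have hx : f x = c := hc x
        have hy : f y = c := hc y
        rw [← hu, h0, hx, hy]
        simp
      · rw [← hu, ← div_le_iff₀ ((E.nonneg u).lt_of_ne' h0)]
        exact le_csSup (E.bddAbove x y) ⟨u, h0, rfl⟩
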